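/- Consider a random network in the plane. The transmitters form a homogeneous Poisson point process with density $\lambda>0$. The receiver of each transmitter is displaced from it by a vector that is uniformly distributed (with respect to area) in the annulus $\{u: 1\le\|u\|\le R_{\rm d}\}$, where $R_{\rm d}>1$. Each receiver has $N_{\rm r}\ge 1$ antennas, and the entries of the fading vectors ${\bf h}_{k,\ell}\in\mathbb{C}^{N_{\rm r}}$ (from transmitter $\ell$ to receiver $k$) are i.i.d. $\mathcal{CN}(0,1)$; the displacements are i.i.d., and transmitter positions, displacements and fading are independent. Let $d_{k,\ell}$ be the distance from transmitter $\ell$ to receiver $k$ and let $\alpha>2$ be the path-loss exponent. In the interference-limited regime (no noise), the signal-to-interference ratio of link $k$ under maximum ratio combining, which uses only the direct channel ${\bf h}_{k,k}$, is $$\mathrm{SIR}_k=\frac{H_{k,k}\,d_{k,k}^{-\alpha}}{\sum_{\ell\ne k}H_{k,\ell}\,d_{k,\ell}^{-\alpha}},\qquad H_{k,\ell}=\frac{|{\bf h}_{k,k}^*{\bf h}_{k,\ell}|^2}{\|{\bf h}_{k,k}\|_2^2}.$$ For a Borel set $\mathcal{A}\subset\mathbb{R}^2$ with area $0<|\mathcal{A}|<\infty$,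 the sum spectral efficiency per unit area is $$C^{\rm mrc}_\Sigma=\frac{1}{|\mathcal{A}|}\,\mathbb{E}\Big[\sum_{k:\ \text{transmitter } k\text{ in }\mathcal{A}}\log_2(1+\mathrm{SIR}_k)\Big],$$ so that $C^{\rm mrc}_\Sigma/\lambda$ is the ergodic spectral efficiency of the typical link (expectation under the Palm probability). Theorem (scaling law with direct CSIR). Let $c>0$ and $\beta\ge 0$, and let $N_{\rm r}=c\lambda^\beta$, where, if $c\lambda^\beta$ is not an integer, $N_{\rm r}$ is any positive integer with $|N_{\rm r}-c\lambda^\beta|<1$. Then $$\frac{C^{\rm mrc}_\Sigma}{\lambda}=\Theta\!\left(\log_2\!\left(1+\lambda^{\beta-\frac{\alpha}{2}}\right)\right)\qquad\text{as }\lambda\to\infty,$$ that is, there are constants $k_1,k_2,\lambda_0>0$, depending only on $\alpha,R_{\rm d},c,\beta$, such that for all $\lambda\ge\lambda_0$ $$k_1\log_2\!\left(1+\lambda^{\beta-\frac{\alpha}{2}}\right)\le\frac{C^{\rm mrc}_\Sigma}{\lambda}\le k_2\log_2\!\left(1+\lambda^{\beta-\frac{\alpha}{2}}\right).$$ -/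

import Mathlib

open MeasureTheory ProbabilityTheory
open scoped ENNReal NNReal

noncomputable section

/-- The Euclidean plane in which the transmitters and receivers are located. -/
abbrev Plane : Type := EuclideanSpace ℝ (Fin 2)

/-- The circularly symmetric complex Gaussian law `CN(0, 1)`: real and imaginary parts are
independent real Gaussians with mean `0` and variance `1/2`. -/
def stdComplexGaussian : Measure ℂ :=
  ((gaussianReal 0 (1 / 2)).prod (gaussianReal 0 (1 / 2))).map
    (fun p : ℝ × ℝ => (⟨p.1, p.2⟩ : ℂ))

/-- The ring around the origin with inner radius `1` and outer radius `Rd`. -/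
def ring (Rd : ℝ) : Set Plane := {u | 1 ≤ ‖u‖ ∧ ‖u‖ ≤ Rd}

/-- The number of points of the sequence `X` that lie in `B`. -/
def pointCount {Ω : Type*} (X : ℕ → Ω → Plane) (B : Set Plane) (ω : Ω) : ℕ∞ :=
  {k : ℕ | X k ω ∈ B}.encard

/-- The random points `X 0, X 1, …` form a homogeneous Poisson point process in the plane with
density `lam`: the number of points in a Borel set of finite area `a` is Poisson distributed with
mean `lam * a`, and the numbers of points in disjoint such sets are independent. -/
structure IsHomogeneousPPP {Ω : Type*} [MeasurableSpace Ω] (P : Measure Ω)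
    (lam : ℝ) (X : ℕ → Ω → Plane) : Prop where
  measurable : ∀ k, Measurable (X k)
  count_law : ∀ B : Set Plane, MeasurableSet B → volume B ≠ ∞ → ∀ n : ℕ,
    P {ω | pointCount X B ω = n} = poissonMeasure (Real.toNNReal (lam * volume.real B)) {n}
  count_indep : ∀ (m : ℕ) (B : Fin m → Set Plane), (∀ i, MeasurableSet (B i)) →
    (∀ i, volume (B i) ≠ ∞) → Pairwise (Function.onFun Disjoint B) →
    iIndepFun (fun i => pointCount X (B i)) P

/-- The random network of transmit-receive pairs with density `lam`, communication range `Rd` and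
`N` antennas at each receiver, on the probability space `(Ω, P)`. -/
structure LinkNetwork {Ω : Type*} [MeasurableSpace Ω] (P : Measure Ω) (lam Rd : ℝ) (N : ℕ) where
  /-- the position of transmitter `k` -/
  tx : ℕ → Ω → Plane
  /-- the position of receiver `k` relative to transmitter `k` -/
  offset : ℕ → Ω → Plane
  /-- `fading k l` is the fading vector of the channel from transmitter `l` to receiver `k` -/
  fading : ℕ → ℕ → Ω → EuclideanSpace ℂ (Fin N)
  tx_ppp : IsHomogeneousPPP P lam tx
  offset_measurable : ∀ k, Measurable (offset k)
  offset_law : ∀ k, P.map (offset k) = cond volume (ring Rd)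
  offset_indep : iIndepFun offset P
  fading_measurable : ∀ k l i, Measurable (fun ω => fading k l ω i)
  fading_law : ∀ k l i, P.map (fun ω => fading k l ω i) = stdComplexGaussian
  fading_indep : iIndepFun (fun (p : ℕ × ℕ × Fin N) ω => fading p.1 p.2.1 ω p.2.2) P
  /-- positions of the transmitters, relative positions of the receivers and fading are
  independent (this field and the next one) -/
  tx_indep : IndepFun (fun ω k => tx k ω)
    (fun ω => ((fun k => offset k ω, fun k l i => fading k l ω i) :
      (ℕ → Plane) × (ℕ → ℕ → Fin N → ℂ))) P
  offset_indep_fading : IndepFun (fun ω k => offset k ω) (fun ω k l i => fading k l ω i) P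

/-- `log₂ (1 + s)` for `s ∈ [0, ∞]`. -/
def log2OnePlus (s : ℝ≥0∞) : ℝ≥0∞ :=
  if s = ∞ then ∞ else ENNReal.ofReal (Real.logb 2 (1 + s.toReal))

namespace LinkNetwork

variable {Ω : Type*} [MeasurableSpace Ω] {P : Measure Ω} {lam Rd : ℝ} {N : ℕ}

/-- The position of receiver `k`. -/
def rx (𝒩 : LinkNetwork P lam Rd N) (k : ℕ) (ω : Ω) : Plane := 𝒩.tx k ω + 𝒩.offset k ω

/-- The fading power `|h_{k,k}^* h_{k,l}|² / ‖h_{k,k}‖²` of the signal of transmitter `l` at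
receiver `k` after maximum ratio combining. -/
def mrcPower (𝒩 : LinkNetwork P lam Rd N) (k l : ℕ) (ω : Ω) : ℝ≥0∞ :=
  ENNReal.ofReal
    (‖inner ℂ (𝒩.fading k k ω) (𝒩.fading k l ω)‖ ^ 2 / ‖𝒩.fading k k ω‖ ^ 2)

/-- The path loss `d ^ (-α)` from transmitter `l` to receiver `k`. -/
def pathLoss (𝒩 : LinkNetwork P lam Rd N) (α : ℝ) (k l : ℕ) (ω : Ω) : ℝ≥0∞ :=
  edist (𝒩.rx k ω) (𝒩.tx l ω) ^ (-α)

/-- The aggregated interference power at receiver `k`. -/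
def interference (𝒩 : LinkNetwork P lam Rd N) (α : ℝ) (k : ℕ) (ω : Ω) : ℝ≥0∞ :=
  ∑' l : {l : ℕ // l ≠ k}, 𝒩.mrcPower k l ω * 𝒩.pathLoss α k l ω

/-- The instantaneous signal-to-interference-plus-noise ratio of link `k` with maximum ratio
combining; `invSNR` is the noise variance divided by the transmit power. -/
def mrcSINR (𝒩 : LinkNetwork P lam Rd N) (α : ℝ) (invSNR : ℝ≥0∞) (k : ℕ) (ω : Ω) : ℝ≥0∞ :=
  𝒩.mrcPower k k ω * 𝒩.pathLoss α k k ω / (𝒩.interference α k ω + invSNR)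

/-- The sum of the ergodic spectral efficiencies of the links with transmitter in the region `A`,
per unit area. Divided by `lam` it is, by definition of the Palm probability, the ergodic spectral
efficiency of the typical link. -/
def mrcSumSpectralEfficiency (𝒩 : LinkNetwork P lam Rd N) (α : ℝ) (invSNR : ℝ≥0∞)
    (A : Set Plane) : ℝ≥0∞ :=
  (∫⁻ ω, ∑' k : ℕ, {ω' | 𝒩.tx k ω' ∈ A}.indicator
    (fun ω' => log2OnePlus (𝒩.mrcSINR α invSNR k ω')) ω ∂P) / volume A

end LinkNetwork

end

/-!
The idea is that the signal and the interference of the typical link are, up to constants, of their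
natural orders `N` and `lam ^ (α / 2)`, so that the spectral efficiency is of the
order of `log₂ (1 + N lam ^ (-α / 2))`. Maximum ratio combining projects the channel of each
interferer onto an independent direction, so that the interference powers are i.i.d. given the
positions, with a law that does not depend on `N`.

*Localization.* The spectral efficiencies of the links define a measure on the plane,
`LinkNetwork.efficiencyMeasure`, and it suffices to compare it with Lebesgue measure on sets `D`
contained in a disc of radius `lam ^ (-1 / 2)` (`measure_le_of_forall_subset_ball`). On such a cell
the receivers with transmitter in `D` and a given displacement are within the same small disc, so
the sum over the links can be estimated with the number of points in `D` and in sets disjoint from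
`D`, which are independent. This replaces the Palm calculus of the Poisson process.

*Upper bound.* By concavity `log₂ (1 + y)` is at most `log₂ (1 + m) + y / ((1 + m) log 2)` with
`m = lam ^ (β - α / 2)`, so it is enough that the mean signal-to-interference ratio is `O(m)`. For
the mean of the inverse of the interference `I`, write `I⁻¹ = ∫ exp (-s I) ds`. Given the positions,
each interferer within distance `s ^ (1 / α)` of the receiver contributes a factor at most `q < 1` to
`E exp (-s I)` (`lintegral_gain_mul_expNeg_tsum_le`), and the generating function of the Poisson
distribution gives a bound `C exp (-b lam s ^ (2 / α))`
(`IsHomogeneousPPP.lintegral_count_mul_pow_le`), whose integral is a multiple of `lam ^ (-α / 2)`.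

*Lower bound.* With probability bounded below, `‖h‖²` is at least `η N` by Chernoff's bound
(`exists_norm_sq_ge_prob`), and independently the interference is at most `K lam ^ (α / 2)`: with
probability bounded below there is no interferer within the distance `2 lam ^ (-1 / 2)` of the centre
of the receivers of the cell, and the mean interference from outside is `O(lam ^ (α / 2))`, by
a dyadic decomposition that converges because `2 < α`
(`IsHomogeneousPPP.le_lintegral_tsum_one_sub`).
-/

/-! ### Logarithms and exponentials with values in `[0, ∞]` -/

/-- The function `t ↦ e ^ (-t)` on `[0, ∞]`, with `e ^ (-∞) = 0`. -/
noncomputable def expNeg (t : ℝ≥0∞) : ℝ≥0∞ :=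
  if t = ∞ then 0 else ENNReal.ofReal (Real.exp (-t.toReal))

lemma measurable_expNeg : Measurable expNeg :=
  Measurable.ite (measurableSet_singleton _) measurable_const (by fun_prop)

lemma expNeg_ofReal {t : ℝ} (ht : 0 ≤ t) :
    expNeg (ENNReal.ofReal t) = ENNReal.ofReal (Real.exp (-t)) := by
  simp [expNeg, ENNReal.toReal_ofReal ht]

lemma expNeg_zero : expNeg 0 = 1 := by simp [expNeg]

lemma expNeg_antitone : Antitone expNeg := by
  intro a b hab
  unfold expNeg
  split_ifs with h1 h2
  · simp
  · simp
  · simp_all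
  · gcongr

lemma expNeg_add (a b : ℝ≥0∞) : expNeg (a + b) = expNeg a * expNeg b := by
  unfold expNeg
  by_cases ha : a = ∞
  · simp [ha]
  by_cases hb : b = ∞
  · simp [hb]
  simp only [ENNReal.add_eq_top, ha, hb, or_self, if_false, ENNReal.toReal_add ha hb]
  rw [← ENNReal.ofReal_mul (Real.exp_pos _).le, ← Real.exp_add]
  congr 2; ring

lemma expNeg_sum {ι : Type*} (S : Finset ι) (f : ι → ℝ≥0∞) :
    expNeg (∑ i ∈ S, f i) = ∏ i ∈ S, expNeg (f i) := by
  classical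
  induction S using Finset.induction_on with
  | empty => simp [expNeg_zero]
  | insert a S ha ih => rw [Finset.sum_insert ha, Finset.prod_insert ha, expNeg_add, ih]

lemma lintegral_exp_neg_mul_rpow {p b : ℝ} (hp : 0 < p) (hb : 0 < b) :
    ∫⁻ s in Set.Ioi (0 : ℝ), ENNReal.ofReal (Real.exp (-b * s ^ p)) =
      ENNReal.ofReal (b ^ (-1 / p) * Real.Gamma (1 / p + 1)) := by
  rw [← integral_exp_neg_mul_rpow hp hb, ofReal_integral_eq_lintegral_ofReal]
  · have := integrableOn_rpow_mul_exp_neg_mul_rpow (s := 0) (by norm_num) hp hb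
    simpa [IntegrableOn] using this
  · exact Filter.Eventually.of_forall fun _ => (Real.exp_pos _).le

/-- The Laplace representation of `I⁻¹`, which turns the mean of the inverse of a sum of
independent terms into an integral of products. -/
lemma inv_le_lintegral_expNeg (I : ℝ≥0∞) :
    I⁻¹ ≤ ∫⁻ s in Set.Ioi (0 : ℝ), expNeg (ENNReal.ofReal s * I) := by
  by_cases hI : I = ∞
  · simp [hI]
  by_cases h0 : I = 0
  · simp [h0, expNeg_zero]
  have hpos : 0 < I.toReal := ENNReal.toReal_pos h0 hI
  have h1 : ∫⁻ s in Set.Ioi (0 : ℝ), expNeg (ENNReal.ofReal s * I) =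
      ∫⁻ s in Set.Ioi (0 : ℝ), ENNReal.ofReal (Real.exp (-I.toReal * s ^ (1 : ℝ))) := by
    refine setLIntegral_congr_fun measurableSet_Ioi fun s hs => ?_
    have hs : 0 < s := hs
    conv_lhs => rw [← ENNReal.ofReal_toReal hI, ← ENNReal.ofReal_mul hs.le,
      expNeg_ofReal (by positivity)]
    rw [Real.rpow_one]; congr 2; ring
  rw [h1, lintegral_exp_neg_mul_rpow one_pos hpos]
  have : Real.Gamma (1 / 1 + 1) = 1 := by norm_num [Real.Gamma_two]
  rw [this, div_one, Real.rpow_neg_one, mul_one, ENNReal.ofReal_inv_of_pos hpos,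
    ENNReal.ofReal_toReal hI]

lemma log2OnePlus_ofReal {s : ℝ} (hs : 0 ≤ s) :
    log2OnePlus (ENNReal.ofReal s) = ENNReal.ofReal (Real.logb 2 (1 + s)) := by
  simp [log2OnePlus, ENNReal.toReal_ofReal hs]

lemma measurable_log2OnePlus : Measurable log2OnePlus := by
  refine Measurable.ite (measurableSet_singleton _) measurable_const ?_
  unfold Real.logb
  fun_prop

lemma log2OnePlus_mono : Monotone log2OnePlus := by
  intro a b hab
  unfold log2OnePlus
  split_ifs with h1 h2
  · simp
  · simp_all
  · simp
  · have : a.toReal ≤ b.toReal := by gcongr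
    refine ENNReal.ofReal_le_ofReal (Real.logb_le_logb_of_le (by norm_num) ?_ (by linarith))
    have : 0 ≤ a.toReal := ENNReal.toReal_nonneg
    linarith

/-- The tangent of the concave function `log₂ (1 + ·)` at `m`, shifted to have no negative term. -/
lemma log2OnePlus_le {m : ℝ} (hm : 0 < m) (y : ℝ≥0∞) :
    log2OnePlus y ≤ ENNReal.ofReal (Real.logb 2 (1 + m)) +
      ENNReal.ofReal (1 / ((1 + m) * Real.log 2)) * y := by
  have hl : 0 < Real.log 2 := Real.log_pos (by norm_num)
  by_cases hy : y = ∞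
  · rw [hy, ENNReal.mul_top (by simp; positivity)]
    simp
  lift y to ℝ≥0 using hy
  rw [← ENNReal.ofReal_coe_nnreal, log2OnePlus_ofReal y.coe_nonneg, ← ENNReal.ofReal_mul (by positivity),
    ← ENNReal.ofReal_add _ (by positivity)]
  · apply ENNReal.ofReal_le_ofReal
    have hy := y.coe_nonneg
    generalize (y : ℝ) = y at hy
    have h1 : Real.log ((1 + y) / (1 + m)) ≤ (1 + y) / (1 + m) - 1 :=
      Real.log_le_sub_one_of_pos (by positivity)
    rw [Real.log_div (by positivity) (by positivity)] at h1
    have h2 : (1 + y) / (1 + m) - 1 ≤ y / (1 + m) := by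
      rw [div_sub_one (by positivity)]; gcongr; linarith
    unfold Real.logb
    calc Real.log (1 + y) / Real.log 2 ≤ (Real.log (1 + m) + y / (1 + m)) / Real.log 2 := by
          gcongr; linarith
      _ = _ := by field_simp
  · exact Real.logb_nonneg (by norm_num) (by linarith)

lemma div_le_logb_one_add {m : ℝ} (hm : 0 < m) :
    m * (1 / ((1 + m) * Real.log 2)) ≤ Real.logb 2 (1 + m) := by
  have hl : 0 < Real.log 2 := Real.log_pos (by norm_num)
  have h1 := Real.one_sub_inv_le_log_of_pos (show 0 < 1 + m by linarith)
  have h2 : 1 - (1 + m)⁻¹ = m / (1 + m) := by field_simp; ring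
  rw [h2] at h1
  unfold Real.logb
  calc m * (1 / ((1 + m) * Real.log 2)) = (m / (1 + m)) / Real.log 2 := by field_simp
    _ ≤ _ := by gcongr

lemma mul_logb_one_add_le {κ m : ℝ} (hκ : 0 ≤ κ) (hκ1 : κ ≤ 1) (hm : 0 ≤ m) :
    κ * Real.logb 2 (1 + m) ≤ Real.logb 2 (1 + κ * m) := by
  rw [← Real.logb_rpow_eq_mul_logb_of_pos (by linarith)]
  exact Real.logb_le_logb_of_le (by norm_num) (by positivity)
    (rpow_one_add_le_one_add_mul_self (by linarith) hκ hκ1)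

/-! ### Dyadic bounds for the path loss -/

/-- Away from the disc of radius `r` around `c`, the path loss to `c` is dominated by a combination
of indicators of discs with dyadic radii. -/
lemma edist_rpow_neg_le_tsum {α r : ℝ} (hα : 0 ≤ α) (hr : 0 < r) (y c : Plane)
    (h : r ≤ dist y c) :
    edist y c ^ (-α) ≤ ∑' i : ℕ, ENNReal.ofReal ((2 ^ i * r) ^ (-α)) *
      (Metric.ball c (2 ^ (i + 1) * r)).indicator 1 y := by
  have hx : 1 ≤ dist y c / r := by rwa [le_div_iff₀ hr, one_mul]
  obtain ⟨n, hn1, hn2⟩ := exists_nat_pow_near hx (show (1 : ℝ) < 2 by norm_num)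
  rw [le_div_iff₀ hr] at hn1
  rw [div_lt_iff₀ hr] at hn2
  refine le_trans ?_ (ENNReal.le_tsum n)
  have hmem : y ∈ Metric.ball c (2 ^ (n + 1) * r) := hn2
  rw [Set.indicator_of_mem hmem, Pi.one_apply, mul_one, edist_dist,
    ENNReal.ofReal_rpow_of_pos (by linarith)]
  exact ENNReal.ofReal_le_ofReal
    (Real.rpow_le_rpow_of_nonpos (by positivity) hn1 (by linarith))

lemma tsum_dyadic_volume {α r : ℝ} (hα : 2 < α) (hr : 0 < r) (c : Plane) :
    ∑' i : ℕ, ENNReal.ofReal ((2 ^ i * r) ^ (-α)) * volume (Metric.ball c (2 ^ (i + 1) * r)) =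
      ENNReal.ofReal (4 * Real.pi * r ^ (2 - α) * (1 - 2 ^ (2 - α))⁻¹) := by
  have hq : (2 : ℝ) ^ (2 - α) < 1 := Real.rpow_lt_one_of_one_lt_of_neg (by norm_num) (by linarith)
  have hterm : ∀ i : ℕ, ENNReal.ofReal ((2 ^ i * r) ^ (-α)) *
      volume (Metric.ball c (2 ^ (i + 1) * r)) =
      ENNReal.ofReal (4 * Real.pi * r ^ (2 - α) * ((2 : ℝ) ^ (2 - α)) ^ i) := by
    intro i
    rw [EuclideanSpace.volume_ball_fin_two, ← ENNReal.ofReal_pow (by positivity),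
      ← ENNReal.ofReal_mul (by positivity), ← ENNReal.ofReal_mul (by positivity)]
    congr 1
    have h4 : (2 : ℝ) ^ (2 - α) = 4 * 2 ^ (-α) := by
      rw [sub_eq_add_neg, Real.rpow_add (by norm_num), Real.rpow_two]; norm_num
    have hr2 : r ^ (2 - α) = r ^ 2 * r ^ (-α) := by
      rw [sub_eq_add_neg, Real.rpow_add hr, Real.rpow_two]
    rw [h4, hr2, Real.mul_rpow (by positivity) hr.le, ← Real.rpow_pow_comm (by norm_num), mul_pow 4,
      show (4 : ℝ) = 2 ^ 2 by norm_num, ← pow_mul]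
    ring
  simp_rw [hterm]
  rw [← ENNReal.ofReal_tsum_of_nonneg, tsum_mul_left, tsum_geometric_of_lt_one (by positivity) hq]
  · intro i; positivity
  · exact (summable_geometric_of_lt_one (by positivity) hq).mul_left _

/-! ### Complex Gaussian vectors -/

/-- The random vector `h` has i.i.d. coordinates of law `CN(0, 1)`. -/
structure IsStdComplexGaussianVector {Ω : Type*} [MeasurableSpace Ω] (P : Measure Ω) {N : ℕ}
    (h : Ω → EuclideanSpace ℂ (Fin N)) : Prop where
  measurable_coord : ∀ i, Measurable fun ω => h ω i
  law : ∀ i, P.map (fun ω => h ω i) = stdComplexGaussian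
  indep : iIndepFun (fun i ω => h ω i) P

/-- The Laplace transform at `1` of the square of a centred Gaussian variable with variance
`1 / 2`. -/
noncomputable def gaussianSqLaplace : ℝ≥0∞ :=
  ∫⁻ y, ENNReal.ofReal (Real.exp (-y ^ 2)) ∂gaussianReal 0 (1 / 2)

lemma gaussianSqLaplace_lt_one : gaussianSqLaplace < 1 := by
  have : NullSingletonClass (gaussianReal 0 (1 / 2)) := nullSingletonClass_gaussianReal (by norm_num)
  have h1 : ∫⁻ _y, (1 : ℝ≥0∞) ∂gaussianReal 0 (1 / 2) = 1 := by simp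
  have hle : ∀ y : ℝ, ENNReal.ofReal (Real.exp (-y ^ 2)) ≤ 1 := fun y => by
    rw [ENNReal.ofReal_le_one, Real.exp_le_one_iff]; nlinarith [sq_nonneg y]
  rw [← h1]
  refine lintegral_strict_mono (NeZero.ne _) (by fun_prop) ?_ ?_
  · refine ne_top_of_le_ne_top ENNReal.one_ne_top ?_
    rw [← h1]
    exact lintegral_mono hle
  · have : ∀ᵐ y ∂gaussianReal 0 (1 / 2), y ≠ 0 := by
      rw [ae_iff]
      simpa only [not_not, Set.ofPred_eq_eq_singleton] using measure_singleton (0 : ℝ)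
    filter_upwards [this] with y hy
    rw [ENNReal.ofReal_lt_one, Real.exp_lt_one_iff]
    have : 0 < y ^ 2 := by positivity
    linarith

lemma lintegral_sq_gaussianReal (v : ℝ≥0) :
    ∫⁻ y, ENNReal.ofReal (y ^ 2) ∂gaussianReal 0 v = v := by
  have hL : MemLp id 2 (gaussianReal 0 v) := memLp_id_gaussianReal 2
  have h2 := variance_id_gaussianReal (μ := 0) (v := v)
  rw [variance_eq_integral measurable_id.aemeasurable] at h2
  simp only [id, integral_id_gaussianReal, sub_zero] at h2
  rw [← ofReal_integral_eq_lintegral_ofReal (by simpa using hL.integrable_sq)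
    (Filter.Eventually.of_forall fun y => sq_nonneg y), h2]
  simp

lemma stdComplexGaussian_map_re_mul (a : ℂ) :
    stdComplexGaussian.map (fun z => a.re * z.re + a.im * z.im) =
      gaussianReal 0 (‖a‖₊ ^ 2 / 2) := by
  have hm : Measurable (fun p : ℝ × ℝ => (⟨p.1, p.2⟩ : ℂ)) :=
    Complex.measurableEquivRealProd.symm.measurable
  rw [stdComplexGaussian, Measure.map_map (by fun_prop) hm]
  have h1 : ((gaussianReal 0 (1 / 2)).prod (gaussianReal 0 (1 / 2))).map
      ((fun z : ℂ => a.re * z.re + a.im * z.im) ∘ fun p : ℝ × ℝ => (⟨p.1, p.2⟩ : ℂ)) =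
      ((gaussianReal 0 (1 / 2)).map (a.re * ·)) ∗ ((gaussianReal 0 (1 / 2)).map (a.im * ·)) := by
    rw [Measure.conv, Measure.map_prod_map _ _ (by fun_prop) (by fun_prop),
      Measure.map_map (by fun_prop) (by fun_prop)]
    rfl
  rw [h1, gaussianReal_map_const_mul, gaussianReal_map_const_mul, gaussianReal_conv_gaussianReal]
  congr 1
  · simp
  · ext
    push_cast
    change a.re ^ 2 * (1 / 2) + a.im ^ 2 * (1 / 2) = ‖a‖ ^ 2 / 2
    rw [Complex.sq_norm, Complex.normSq_apply]
    ring

namespace IsStdComplexGaussianVector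

variable {Ω : Type*} [MeasurableSpace Ω] {P : Measure Ω} {N : ℕ}
  {h : Ω → EuclideanSpace ℂ (Fin N)}

lemma measurable (hh : IsStdComplexGaussianVector P h) : Measurable h := by
  exact (MeasurableEquiv.toLp 2 (Fin N → ℂ)).measurable.comp
    (measurable_pi_lambda (fun ω i => h ω i) hh.measurable_coord)

lemma map_re_inner (hh : IsStdComplexGaussianVector P h) (v : EuclideanSpace ℂ (Fin N)) :
    P.map (fun ω => (inner ℂ v (h ω)).re) = gaussianReal 0 (‖v‖₊ ^ 2 / 2) := by
  have := hh.indep.isProbabilityMeasure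
  have hg : ∀ i, Measurable fun z : ℂ => (v i).re * z.re + (v i).im * z.im := fun i => by fun_prop
  have h1 : (fun ω => (inner ℂ v (h ω)).re) =
      fun ω => ∑ i, ((v i).re * (h ω i).re + (v i).im * (h ω i).im) := by
    ext ω
    simp only [PiLp.inner_apply, RCLike.inner_apply, Complex.re_sum, Complex.mul_re,
      Complex.conj_re, Complex.conj_im]
    exact Finset.sum_congr rfl fun i _ => by ring
  have hind := hh.indep.comp _ hg
  have hm : Measurable (fun ω => ∑ i, ((v i).re * (h ω i).re + (v i).im * (h ω i).im)) :=
    Finset.measurable_sum _ fun i _ => (hg i).comp (hh.measurable_coord i)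
  rw [h1]
  have := Measure.isProbabilityMeasure_map (μ := P) hm.aemeasurable
  refine Measure.ext_of_charFun ?_
  have h2 := hind.charFun_map_fun_sum_eq_prod
    (fun i => ((hg i).comp (hh.measurable_coord i)).aemeasurable)
  have h3 : ∀ i, P.map ((fun z : ℂ => (v i).re * z.re + (v i).im * z.im) ∘ fun ω => h ω i) =
      gaussianReal 0 (‖v i‖₊ ^ 2 / 2) := fun i => by
    rw [← Measure.map_map (hg i) (hh.measurable_coord i), hh.law, stdComplexGaussian_map_re_mul]
  simp_rw [h3] at h2
  simp only [Function.comp_def] at h2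
  rw [h2]
  ext t
  rw [Finset.prod_apply]
  simp_rw [charFun_gaussianReal]
  rw [← Complex.exp_sum]
  congr 1
  have h4 : ‖v‖ ^ 2 = ∑ i, ‖v i‖ ^ 2 := EuclideanSpace.norm_sq_eq v
  have h5 : ((‖v‖ : ℂ)) ^ 2 = ∑ i, (‖v i‖ : ℂ) ^ 2 := by exact_mod_cast h4
  simp only [NNReal.coe_div, NNReal.coe_pow, coe_nnnorm, NNReal.coe_ofNat, Complex.ofReal_div,
    Complex.ofReal_pow, Complex.ofReal_ofNat, h5, Complex.ofReal_zero, mul_zero, zero_mul,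
    zero_sub, Finset.sum_neg_distrib, Finset.sum_div, Finset.sum_mul]

lemma lintegral_norm_inner_sq (hh : IsStdComplexGaussianVector P h)
    (v : EuclideanSpace ℂ (Fin N)) :
    ∫⁻ ω, ENNReal.ofReal (‖inner ℂ v (h ω)‖ ^ 2) ∂P = ENNReal.ofReal (‖v‖ ^ 2) := by
  have hmeas := hh.measurable
  have key : ∀ w : EuclideanSpace ℂ (Fin N),
      ∫⁻ ω, ENNReal.ofReal ((inner ℂ w (h ω)).re ^ 2) ∂P = ENNReal.ofReal (‖w‖ ^ 2 / 2) := by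
    intro w
    have := lintegral_sq_gaussianReal (‖w‖₊ ^ 2 / 2)
    rw [← hh.map_re_inner w, lintegral_map (by fun_prop) (by fun_prop)] at this
    rw [this, ← ENNReal.ofReal_coe_nnreal]
    simp
  have h1 : ∀ ω, ENNReal.ofReal (‖inner ℂ v (h ω)‖ ^ 2) =
      ENNReal.ofReal ((inner ℂ v (h ω)).re ^ 2) +
        ENNReal.ofReal ((inner ℂ (Complex.I • v) (h ω)).re ^ 2) := by
    intro ω
    rw [← ENNReal.ofReal_add (sq_nonneg _) (sq_nonneg _), Complex.sq_norm, Complex.normSq_apply,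
      inner_smul_left]
    congr 1
    simp [sq]
  simp_rw [h1]
  rw [lintegral_add_left (by fun_prop), key, key, norm_smul,
    ← ENNReal.ofReal_add (by positivity) (by positivity)]
  congr 1
  simp

lemma lintegral_expNeg_norm_inner_sq_le (hh : IsStdComplexGaussianVector P h)
    {v : EuclideanSpace ℂ (Fin N)} (hv : v ≠ 0) :
    ∫⁻ ω, expNeg (ENNReal.ofReal (‖inner ℂ v (h ω)‖ ^ 2 / ‖v‖ ^ 2)) ∂P ≤ gaussianSqLaplace := by
  have hmeas := hh.measurable
  have hv' : ‖v‖ ≠ 0 := norm_ne_zero_iff.2 hv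
  set u : EuclideanSpace ℂ (Fin N) := ((‖v‖⁻¹ : ℝ) : ℂ) • v with hu
  have hun : ‖u‖₊ = 1 := by
    ext; rw [coe_nnnorm, hu, norm_smul]
    simp [hv']
  have hlaw := hh.map_re_inner u
  rw [hun, one_pow] at hlaw
  rw [gaussianSqLaplace, ← hlaw, lintegral_map (by fun_prop) (by fun_prop)]
  refine lintegral_mono fun ω => ?_
  rw [expNeg_ofReal (by positivity)]
  gcongr
  have h1 : ‖inner ℂ v (h ω)‖ ^ 2 / ‖v‖ ^ 2 = ‖inner ℂ u (h ω)‖ ^ 2 := by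
    rw [hu, inner_smul_left, norm_mul, mul_pow]
    simp
    field_simp
  rw [h1, Complex.sq_norm, Complex.normSq_apply]
  nlinarith [sq_nonneg (inner ℂ u (h ω)).im]

lemma inner_single_one (i : Fin N) (x : EuclideanSpace ℂ (Fin N)) :
    inner ℂ (EuclideanSpace.single i (1 : ℂ)) x = x i := by
  rw [EuclideanSpace.inner_single_left, map_one, one_mul]

lemma lintegral_norm_sq (hh : IsStdComplexGaussianVector P h) :
    ∫⁻ ω, ENNReal.ofReal (‖h ω‖ ^ 2) ∂P = (N : ℝ≥0∞) := by
  have hm : ∀ i, Measurable fun ω => ENNReal.ofReal (‖h ω i‖ ^ 2) := fun i =>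
    ((hh.measurable_coord i).norm.pow_const 2).ennreal_ofReal
  have h1 : ∀ ω, ENNReal.ofReal (‖h ω‖ ^ 2) = ∑ i, ENNReal.ofReal (‖h ω i‖ ^ 2) := fun ω => by
    rw [EuclideanSpace.norm_sq_eq, ENNReal.ofReal_sum_of_nonneg fun i _ => sq_nonneg _]
  have h2 : ∀ i, ∫⁻ ω, ENNReal.ofReal (‖h ω i‖ ^ 2) ∂P = 1 := fun i => by
    have := hh.lintegral_norm_inner_sq (EuclideanSpace.single i (1 : ℂ))
    simpa only [inner_single_one, PiLp.norm_single, norm_one, one_pow,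
      ENNReal.ofReal_one] using this
  calc ∫⁻ ω, ENNReal.ofReal (‖h ω‖ ^ 2) ∂P
      = ∫⁻ ω, ∑ i, ENNReal.ofReal (‖h ω i‖ ^ 2) ∂P := lintegral_congr h1
    _ = ∑ i, ∫⁻ ω, ENNReal.ofReal (‖h ω i‖ ^ 2) ∂P := lintegral_finsetSum _ fun i _ => hm i
    _ = (N : ℝ≥0∞) := by
      rw [Finset.sum_congr rfl fun i _ => h2 i, Finset.sum_const, Finset.card_univ,
        Fintype.card_fin, nsmul_one]

lemma lintegral_expNeg_norm_sq_le (hh : IsStdComplexGaussianVector P h) :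
    ∫⁻ ω, expNeg (ENNReal.ofReal (‖h ω‖ ^ 2)) ∂P ≤ gaussianSqLaplace ^ N := by
  have hmeas := hh.measurable_coord
  have hg : Measurable fun z : ℂ => expNeg (ENNReal.ofReal (‖z‖ ^ 2)) :=
    measurable_expNeg.comp (by fun_prop)
  have h1 : ∀ ω, expNeg (ENNReal.ofReal (‖h ω‖ ^ 2)) =
      ∏ i, expNeg (ENNReal.ofReal (‖h ω i‖ ^ 2)) := fun ω => by
    rw [EuclideanSpace.norm_sq_eq, ENNReal.ofReal_sum_of_nonneg fun i _ => sq_nonneg _, expNeg_sum]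
  simp_rw [h1]
  have h2 := lintegral_prod_eq_prod_lintegral_of_indepFun (μ := P) Finset.univ _
    (hh.indep.comp _ fun _ => hg) fun i => hg.comp (hmeas i)
  simp only [Function.comp_def] at h2
  rw [h2]
  calc _ ≤ ∏ _i : Fin N, gaussianSqLaplace := by
        refine Finset.prod_le_prod' fun i _ => ?_
        have hne : EuclideanSpace.single i (1 : ℂ) ≠ 0 := by simp
        have := hh.lintegral_expNeg_norm_inner_sq_le hne
        simpa only [inner_single_one, PiLp.norm_single, norm_one, one_pow,
          div_one] using this
    _ = _ := by simp

end IsStdComplexGaussianVector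

/-- Chernoff's bound: the squared norm of a standard complex Gaussian vector is at least a fixed
fraction of its dimension, with a probability bounded below uniformly in the dimension. -/
lemma exists_norm_sq_ge_prob : ∃ η > (0 : ℝ), ∃ p > (0 : ℝ), ∀ {Ω : Type*} [MeasurableSpace Ω]
    {P : Measure Ω} {N : ℕ} {h : Ω → EuclideanSpace ℂ (Fin N)}, 0 < N →
    IsStdComplexGaussianVector P h → ENNReal.ofReal p ≤ P {ω | η * N ≤ ‖h ω‖ ^ 2} := by
  obtain ⟨q, hq1, hq2, hq3⟩ : ∃ q : ℝ, gaussianSqLaplace ≤ ENNReal.ofReal q ∧ 0 < q ∧ q < 1 := by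
    refine ⟨max gaussianSqLaplace.toReal (1 / 2), ?_, by positivity, ?_⟩
    · rw [← ENNReal.ofReal_toReal (gaussianSqLaplace_lt_one.trans ENNReal.one_lt_top).ne]
      exact ENNReal.ofReal_le_ofReal (by simp)
    · refine max_lt ?_ (by norm_num)
      have := ENNReal.toReal_strict_mono ENNReal.one_ne_top gaussianSqLaplace_lt_one
      simpa using this
  set η := - Real.log q / 2 with hη
  have hlog : Real.log q < 0 := Real.log_neg hq2 hq3
  have hr : Real.exp η * q < 1 := by
    calc Real.exp η * q = Real.exp (η + Real.log q) := by rw [Real.exp_add, Real.exp_log hq2]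
      _ < 1 := by rw [Real.exp_lt_one_iff, hη]; linarith
  refine ⟨η, by linarith, 1 - Real.exp η * q, by linarith, ?_⟩
  intro Ω _ P N h hN hh
  have hmeas := hh.measurable
  have := hh.indep.isProbabilityMeasure
  have hms : MeasurableSet {ω | η * N ≤ ‖h ω‖ ^ 2} := measurableSet_le (by fun_prop) (by fun_prop)
  have h1 : P {ω | η * N ≤ ‖h ω‖ ^ 2}ᶜ ≤ ENNReal.ofReal (Real.exp η * q) := by
    have hM := mul_meas_ge_le_lintegral (μ := P)
      (f := fun ω => expNeg (ENNReal.ofReal (‖h ω‖ ^ 2)))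
      (measurable_expNeg.comp (by fun_prop)) (ENNReal.ofReal (Real.exp (-(η * N))))
    have hsub : {ω | η * N ≤ ‖h ω‖ ^ 2}ᶜ ⊆ {ω | ENNReal.ofReal (Real.exp (-(η * N))) ≤
        expNeg (ENNReal.ofReal (‖h ω‖ ^ 2))} := by
      intro ω hω
      simp only [Set.mem_compl_iff, Set.mem_ofPred_eq, not_le] at hω ⊢
      rw [expNeg_ofReal (by positivity)]
      gcongr
    have h3 := (mul_le_mul_right (measure_mono hsub) _).trans
      (hM.trans (hh.lintegral_expNeg_norm_sq_le.trans (pow_le_pow_left' hq1 N)))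
    calc P {ω | η * N ≤ ‖h ω‖ ^ 2}ᶜ
        = ENNReal.ofReal (Real.exp (η * N)) * (ENNReal.ofReal (Real.exp (-(η * N))) *
            P {ω | η * N ≤ ‖h ω‖ ^ 2}ᶜ) := by
          rw [← mul_assoc, ← ENNReal.ofReal_mul (Real.exp_pos _).le, ← Real.exp_add]
          simp
      _ ≤ ENNReal.ofReal (Real.exp (η * N)) * ENNReal.ofReal q ^ N := by gcongr
      _ = ENNReal.ofReal ((Real.exp η * q) ^ N) := by
          rw [← ENNReal.ofReal_pow hq2.le, ← ENNReal.ofReal_mul (Real.exp_pos _).le, mul_pow,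
            ← Real.exp_nat_mul, mul_comm η]
      _ ≤ _ := ENNReal.ofReal_le_ofReal (pow_le_of_le_one (by positivity) hr.le hN.ne')
  have h2 := prob_compl_eq_one_sub (μ := P) hms.compl
  rw [compl_compl] at h2
  rw [h2, ENNReal.ofReal_sub _ (by positivity), ENNReal.ofReal_one]
  gcongr

/-! ### Independence and integration -/

/-- Grouping the members of an independent family by the first index gives independent families. -/
lemma iIndepFun_curry {Ω ι κ E : Type*} [MeasurableSpace Ω] [MeasurableSpace E] {P : Measure Ω}
    {X : ι → κ → Ω → E} (mX : ∀ i j, Measurable (X i j))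
    (hX : iIndepFun (fun (p : ι × κ) ω => X p.1 p.2 ω) P) :
    iIndepFun (fun i ω j => X i j ω) P := by
  have := hX.isProbabilityMeasure
  have : ∀ i j, IsProbabilityMeasure (P.map (X i j)) :=
    fun i j => Measure.isProbabilityMeasure_map (mX i j).aemeasurable
  have hrow : ∀ i, P.map (fun ω j => X i j ω) = Measure.infinitePi fun j => P.map (X i j) :=
    fun i => (hX.precomp (Prod.mk_right_injective i)).map_fun_eq_infinitePi_map (mX i)
  rw [iIndepFun_iff_map_fun_eq_infinitePi_map
    (fun i => measurable_pi_lambda _ fun j => mX i j)]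
  simp_rw [hrow]
  have hmp : Measurable fun ω (p : ι × κ) => X p.1 p.2 ω :=
    measurable_pi_lambda _ fun p => mX p.1 p.2
  have hlaw : P.map (fun ω (p : ι × κ) => X p.1 p.2 ω) =
      Measure.infinitePi fun p : ι × κ => P.map (X p.1 p.2) :=
    hX.map_fun_eq_infinitePi_map (X := fun (p : ι × κ) ω => X p.1 p.2 ω) fun p => mX p.1 p.2
  calc P.map (fun ω i j => X i j ω)
      = (P.map fun ω (p : ι × κ) => X p.1 p.2 ω).map (MeasurableEquiv.curry ι κ E) := by
        rw [Measure.map_map (by fun_prop) hmp]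
        rfl
    _ = _ := by
        rw [hlaw]
        exact Measure.infinitePi_map_curry fun i j => P.map (X i j)

lemma lintegral_comp_of_indepFun {Ω E F : Type*} [MeasurableSpace Ω] [MeasurableSpace E]
    [MeasurableSpace F] {P : Measure Ω} [IsFiniteMeasure P] {X : Ω → E} {Y : Ω → F}
    (hX : Measurable X) (hY : Measurable Y) (hXY : IndepFun X Y P) {f : E → F → ℝ≥0∞}
    (hf : Measurable (Function.uncurry f)) :
    ∫⁻ ω, f (X ω) (Y ω) ∂P = ∫⁻ ω, ∫⁻ ω', f (X ω) (Y ω') ∂P ∂P := by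
  have h1 := (indepFun_iff_map_prod_eq_prod_map_map hX.aemeasurable hY.aemeasurable).1 hXY
  calc ∫⁻ ω, f (X ω) (Y ω) ∂P
      = ∫⁻ z, Function.uncurry f z ∂(P.map fun ω => (X ω, Y ω)) :=
        (lintegral_map hf (hX.prodMk hY)).symm
    _ = ∫⁻ x, ∫⁻ y, f x y ∂(P.map Y) ∂(P.map X) := by
        rw [h1, lintegral_prod _ hf.aemeasurable]; rfl
    _ = ∫⁻ ω, ∫⁻ y, f (X ω) y ∂(P.map Y) ∂P := lintegral_map hf.lintegral_prod_right' hX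
    _ = _ := lintegral_congr fun ω => lintegral_map (hf.comp measurable_prodMk_left) hY

/-! ### Interference after maximum ratio combining, for given positions -/

/-- The fading power of a signal received through the channel `w` after combining with the
direction of `v`. -/
noncomputable def combiningGain {N : ℕ} (v w : EuclideanSpace ℂ (Fin N)) : ℝ≥0∞ :=
  ENNReal.ofReal (‖inner ℂ v w‖ ^ 2 / ‖v‖ ^ 2)

lemma measurable_combiningGain {N : ℕ} {Ω : Type*} [MeasurableSpace Ω]
    {f g : Ω → EuclideanSpace ℂ (Fin N)} (hf : Measurable f) (hg : Measurable g) :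
    Measurable fun ω => combiningGain (f ω) (g ω) := by
  unfold combiningGain
  exact (((hf.inner hg).norm.pow_const 2).div (hf.norm.pow_const 2)).ennreal_ofReal

lemma combiningGain_self {N : ℕ} (v : EuclideanSpace ℂ (Fin N)) :
    combiningGain v v = ENNReal.ofReal (‖v‖ ^ 2) := by
  unfold combiningGain
  by_cases hv : v = 0
  · simp [hv]
  have : ‖v‖ ≠ 0 := norm_ne_zero_iff.2 hv
  rw [inner_self_eq_norm_sq_to_K]
  congr 1
  simp
  field_simp

section Fading

variable {Ω : Type*} [MeasurableSpace Ω] {P : Measure Ω} {N : ℕ}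
  {h : ℕ → Ω → EuclideanSpace ℂ (Fin N)}

/-- The interferers in a finite set act as independent gains, even after conditioning on the
direct channel, and each of them contributes a factor at most `gaussianSqLaplace`. -/
lemma lintegral_gain_mul_expNeg_sum_le (hh : ∀ l, IsStdComplexGaussianVector P (h l))
    (hind : iIndepFun h P) {k : ℕ} {S : Finset ℕ} (hk : k ∉ S) :
    ∫⁻ ω, combiningGain (h k ω) (h k ω) * expNeg (∑ l ∈ S, combiningGain (h k ω) (h l ω)) ∂P ≤
      N * gaussianSqLaplace ^ S.card := by
  have := hind.isProbabilityMeasure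
  have hm := fun l => (hh l).measurable
  have hI : IndepFun (h k) (fun ω (l : S) => h l ω) P := by
    have h1 := hind.indepFun_finset {k} S (by simpa using hk) hm
    exact h1.comp (φ := fun x : ({k} : Finset ℕ) → EuclideanSpace ℂ (Fin N) =>
      x ⟨k, Finset.mem_singleton_self k⟩) (ψ := id) (measurable_pi_apply _) measurable_id
  have hf : Measurable (Function.uncurry fun (v : EuclideanSpace ℂ (Fin N))
      (y : S → EuclideanSpace ℂ (Fin N)) =>
      combiningGain v v * expNeg (∑ l : S, combiningGain v (y l))) := by
    refine Measurable.mul (measurable_combiningGain measurable_fst measurable_fst)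
      (measurable_expNeg.comp (Finset.measurable_sum _ fun l _ => ?_))
    exact measurable_combiningGain measurable_fst ((measurable_pi_apply l).comp measurable_snd)
  have h2 := lintegral_comp_of_indepFun (hm k) (measurable_pi_lambda _ fun l : S => hm l) hI hf
  have h3 : ∀ ω, (∑ l : S, combiningGain (h k ω) (h l ω)) =
      ∑ l ∈ S, combiningGain (h k ω) (h l ω) := fun ω =>
    Finset.sum_coe_sort S fun l => combiningGain (h k ω) (h l ω)
  simp_rw [h3] at h2
  rw [h2]
  calc _ ≤ ∫⁻ ω, combiningGain (h k ω) (h k ω) * gaussianSqLaplace ^ S.card ∂P := by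
        refine lintegral_mono fun ω => ?_
        generalize h k ω = v
        by_cases hv : v = 0
        · simp [hv, combiningGain_self]
        have hmg : ∀ l, Measurable fun ω => expNeg (combiningGain v (h l ω)) := fun l =>
          measurable_expNeg.comp (measurable_combiningGain measurable_const (hm l))
        have h4 : ∀ ω, expNeg (∑ l : S, combiningGain v (h l ω)) =
            ∏ l ∈ S, expNeg (combiningGain v (h l ω)) := fun ω => by
          rw [Finset.sum_coe_sort S fun l => combiningGain v (h l ω), expNeg_sum]
        have h5 := lintegral_prod_eq_prod_lintegral_of_indepFun (μ := P) S
          (fun l ω => expNeg (combiningGain v (h l ω)))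
          (hind.comp (fun _ w => expNeg (combiningGain v w)) fun l =>
            measurable_expNeg.comp (measurable_combiningGain measurable_const measurable_id)) hmg
        simp_rw [h4]
        rw [lintegral_const_mul _ (Finset.measurable_prod _ fun l _ => hmg l), h5]
        gcongr
        refine (Finset.prod_le_prod' fun l _ => (hh l).lintegral_expNeg_norm_inner_sq_le hv).trans ?_
        rw [Finset.prod_const]
    _ = N * gaussianSqLaplace ^ S.card := by
        rw [lintegral_mul_const _ (measurable_combiningGain (hm k) (hm k))]
        simp_rw [combiningGain_self]
        rw [(hh k).lintegral_norm_sq]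

/-- If the interferers in `S` have path loss at least `s⁻¹`, the Laplace transform of the
interference at `s`, weighted by the signal gain, decays geometrically in the size of `S`. For
infinite `S` the statement holds because then `S.ncard = 0`. -/
lemma lintegral_gain_mul_expNeg_tsum_le (hh : ∀ l, IsStdComplexGaussianVector P (h l))
    (hind : iIndepFun h P) {k : ℕ} {a : ℕ → ℝ≥0∞} {s : ℝ≥0∞} {S : Set ℕ}
    (hS : ∀ l ∈ S, l ≠ k ∧ 1 ≤ s * a l) :
    ∫⁻ ω, combiningGain (h k ω) (h k ω) *
        expNeg (s * ∑' l : {l : ℕ // l ≠ k}, combiningGain (h k ω) (h l ω) * a l) ∂P ≤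
      N * gaussianSqLaplace ^ S.ncard := by
  have hfin : ∀ F : Finset ℕ, ↑F ⊆ S →
      ∫⁻ ω, combiningGain (h k ω) (h k ω) *
        expNeg (s * ∑' l : {l : ℕ // l ≠ k}, combiningGain (h k ω) (h l ω) * a l) ∂P ≤
      N * gaussianSqLaplace ^ F.card := by
    intro F hF
    refine le_trans (lintegral_mono fun ω => ?_)
      (lintegral_gain_mul_expNeg_sum_le hh hind (k := k) (S := F) fun hk => (hS k (hF hk)).1 rfl)
    refine mul_le_mul_right (expNeg_antitone ?_) _
    have hsub := tsum_subtype {l : ℕ | l ≠ k} fun l => combiningGain (h k ω) (h l ω) * a l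
    change ∑' l : {l : ℕ // l ≠ k}, combiningGain (h k ω) (h l ω) * a l = _ at hsub
    rw [hsub, ← ENNReal.tsum_mul_left]
    refine le_trans (Finset.sum_le_sum fun l hl => ?_) (ENNReal.sum_le_tsum F)
    obtain ⟨h1, h2⟩ := hS l (hF hl)
    rw [Set.indicator_of_mem (show l ∈ {l : ℕ | l ≠ k} from h1)]
    calc combiningGain (h k ω) (h l ω) = combiningGain (h k ω) (h l ω) * 1 := (mul_one _).symm
      _ ≤ combiningGain (h k ω) (h l ω) * (s * a l) := by gcongr
      _ = _ := by ring
  by_cases hfs : S.Finite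
  · rw [Set.ncard_eq_toFinset_card S hfs]
    exact hfin _ (by simp)
  · rw [Set.Infinite.ncard hfs]
    simpa using hfin ∅ (by simp)

lemma lintegral_indicator_mul_gain_le (hh : ∀ l, IsStdComplexGaussianVector P (h l))
    (hind : iIndepFun h P) {k l : ℕ} (hkl : l ≠ k) {E : Set (EuclideanSpace ℂ (Fin N))}
    (hE : MeasurableSet E) :
    ∫⁻ ω, E.indicator 1 (h k ω) * combiningGain (h k ω) (h l ω) ∂P ≤ P (h k ⁻¹' E) := by
  have := hind.isProbabilityMeasure
  have hm := fun l => (hh l).measurable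
  have hE1 : Measurable (E.indicator (1 : EuclideanSpace ℂ (Fin N) → ℝ≥0∞)) :=
    measurable_one.indicator hE
  have hf : Measurable (Function.uncurry fun (v w : EuclideanSpace ℂ (Fin N)) =>
      E.indicator 1 v * combiningGain v w) :=
    (hE1.comp measurable_fst).mul (measurable_combiningGain measurable_fst measurable_snd)
  rw [lintegral_comp_of_indepFun (hm k) (hm l) (hind.indepFun hkl.symm) hf]
  calc _ ≤ ∫⁻ ω, E.indicator 1 (h k ω) ∂P := by
        refine lintegral_mono fun ω => ?_
        generalize h k ω = v
        rw [lintegral_const_mul _ (measurable_combiningGain measurable_const (hm l))]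
        refine mul_le_of_le_one_right' ?_
        unfold combiningGain
        by_cases hv : v = 0
        · simp [hv]
        have hv' : 0 < ‖v‖ ^ 2 := by have := norm_pos_iff.2 hv; positivity
        simp_rw [div_eq_mul_inv, ENNReal.ofReal_mul (sq_nonneg _)]
        rw [lintegral_mul_const _ (by have := hm l; fun_prop), (hh l).lintegral_norm_inner_sq,
          ← ENNReal.ofReal_mul hv'.le, mul_inv_cancel₀ hv'.ne', ENNReal.ofReal_one]
    _ = P (h k ⁻¹' E) := lintegral_indicator_one (hm k hE)

/-- With probability bounded below, the direct channel is strong and, by Markov's inequality, the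
interference does not exceed a multiple of its mean. -/
lemma mul_one_sub_le_measure_gain_interference
    (hh : ∀ l, IsStdComplexGaussianVector P (h l)) (hind : iIndepFun h P) {k : ℕ} {a : ℕ → ℝ≥0∞}
    {T p : ℝ≥0∞} (hT : T ≠ 0) (hT' : T ≠ ∞) {E : Set (EuclideanSpace ℂ (Fin N))}
    (hE : MeasurableSet E) (hp : p ≤ P (h k ⁻¹' E)) :
    p * (1 - (∑' l : {l : ℕ // l ≠ k}, a l) / T) ≤
      P {ω | h k ω ∈ E ∧ ∑' l : {l : ℕ // l ≠ k}, combiningGain (h k ω) (h l ω) * a l ≤ T} := by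
  have := hind.isProbabilityMeasure
  have hm := fun l => (hh l).measurable
  set J := ∑' l : {l : ℕ // l ≠ k}, a l with hJ
  set I : Ω → ℝ≥0∞ := fun ω => ∑' l : {l : ℕ // l ≠ k}, combiningGain (h k ω) (h l ω) * a l with hI
  have hE1 : Measurable fun ω => (E.indicator (1 : EuclideanSpace ℂ (Fin N) → ℝ≥0∞)) (h k ω) :=
    (measurable_one.indicator hE).comp (hm k)
  have hg : ∀ l, Measurable fun ω => combiningGain (h k ω) (h l ω) := fun l =>
    measurable_combiningGain (hm k) (hm l)
  have hEg : ∀ l, Measurable fun ω => E.indicator 1 (h k ω) * combiningGain (h k ω) (h l ω) :=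
    fun l => hE1.mul (hg l)
  have hIm : Measurable I := Measurable.tsum fun l => (hg l).mul_const _
  set W := {ω | h k ω ∈ E ∧ T ≤ I ω}
  have hmean : ∫⁻ ω, E.indicator 1 (h k ω) * I ω ∂P ≤ J * P (h k ⁻¹' E) := by
    simp_rw [hI, ← ENNReal.tsum_mul_left, ← mul_assoc]
    rw [lintegral_tsum fun l : {l : ℕ // l ≠ k} => ((hEg l).mul_const (a l)).aemeasurable,
      hJ, ← ENNReal.tsum_mul_right]
    refine ENNReal.tsum_le_tsum fun l => ?_
    rw [lintegral_mul_const _ (hEg l), mul_comm (a l)]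
    gcongr
    exact lintegral_indicator_mul_gain_le hh hind l.2 hE
  have hW : T * P W ≤ J * P (h k ⁻¹' E) := by
    refine le_trans (le_trans ?_ (mul_meas_ge_le_lintegral (hE1.mul hIm) T)) hmean
    gcongr
    rintro ω ⟨h1, h2⟩
    change T ≤ E.indicator 1 (h k ω) * I ω
    rwa [Set.indicator_of_mem h1, Pi.one_apply, one_mul]
  have hW' : P W ≤ P (h k ⁻¹' E) * (J / T) := by
    rw [← mul_div_assoc, ENNReal.le_div_iff_mul_le (Or.inl hT) (Or.inl hT')]
    rwa [mul_comm, mul_comm (P (h k ⁻¹' E))]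
  have hcov : P (h k ⁻¹' E) ≤ P {ω | h k ω ∈ E ∧ I ω ≤ T} + P W := by
    refine (measure_mono fun ω hω => ?_).trans (measure_union_le _ _)
    rcases le_total (I ω) T with h1 | h1
    · exact Or.inl ⟨hω, h1⟩
    · exact Or.inr ⟨hω, h1⟩
  calc p * (1 - J / T) ≤ P (h k ⁻¹' E) * (1 - J / T) := by gcongr
    _ = P (h k ⁻¹' E) - P (h k ⁻¹' E) * (J / T) := by
        rw [ENNReal.mul_sub fun _ _ => measure_ne_top _ _, mul_one]
    _ ≤ _ := by
        rw [tsub_le_iff_right]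
        exact hcov.trans (by gcongr)

end Fading

/-! ### Poisson counts -/

lemma lintegral_natCast_poissonMeasure (r : ℝ≥0) :
    ∫⁻ n : ℕ, (n : ℝ≥0∞) ∂poissonMeasure r = r := by
  rw [lintegral_countable', tsum_eq_zero_add' ENNReal.summable]
  have h : ∀ n : ℕ, ((n + 1 : ℕ) : ℝ≥0∞) * poissonMeasure r {n + 1} = r * poissonMeasure r {n} := by
    intro n
    rw [poissonMeasure_singleton, poissonMeasure_singleton, ← ENNReal.ofReal_natCast,
      ← ENNReal.ofReal_coe_nnreal, ← ENNReal.ofReal_mul (by positivity),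
      ← ENNReal.ofReal_mul (by positivity)]
    congr 1
    rw [Nat.factorial_succ]
    push_cast
    field_simp
    ring
  simp_rw [h]
  have h1 : ∑' n, poissonMeasure r {n} = 1 := by
    have := lintegral_countable' (μ := poissonMeasure r) (fun _ => 1)
    simpa using this.symm
  rw [ENNReal.tsum_mul_left, h1]
  simp

lemma lintegral_pow_poissonMeasure (r q : ℝ≥0) :
    ∫⁻ n : ℕ, (q : ℝ≥0∞) ^ n ∂poissonMeasure r = ENNReal.ofReal (Real.exp (-((1 - q) * r))) := by
  rw [lintegral_countable']
  have h : ∀ n : ℕ, (q : ℝ≥0∞) ^ n * poissonMeasure r {n} =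
      ENNReal.ofReal (Real.exp (-((1 - q) * r))) * poissonMeasure (q * r) {n} := by
    intro n
    rw [poissonMeasure_singleton, poissonMeasure_singleton, ← ENNReal.ofReal_coe_nnreal,
      ← ENNReal.ofReal_pow (by positivity), ← ENNReal.ofReal_mul (by positivity),
      ← ENNReal.ofReal_mul (by positivity)]
    congr 1
    push_cast
    rw [show -(r : ℝ) = -((1 - q) * r) + -(q * r) by ring, Real.exp_add]
    ring
  simp_rw [h]
  have h1 : ∑' n, poissonMeasure (q * r) {n} = 1 := by
    have := lintegral_countable' (μ := poissonMeasure (q * r)) (fun _ => 1)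
    simpa using this.symm
  rw [ENNReal.tsum_mul_left, h1, mul_one]

section PointCount

variable {Ω : Type*} {X : ℕ → Ω → Plane}

lemma coe_pointCount (B : Set Plane) (ω : Ω) :
    (pointCount X B ω : ℝ≥0∞) = ∑' k, B.indicator 1 (X k ω) := by
  rw [pointCount, ← ENNReal.tsum_set_one, tsum_subtype {k | X k ω ∈ B} (fun _ => (1 : ℝ≥0∞))]
  rfl

lemma measurable_pointCount [MeasurableSpace Ω] (hX : ∀ k, Measurable (X k)) {B : Set Plane}
    (hB : MeasurableSet B) : Measurable (pointCount X B) := by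
  have h1 : Measurable fun ω => (pointCount X B ω : ℝ≥0∞) := by
    simp_rw [coe_pointCount]
    exact Measurable.tsum fun k => (measurable_one.indicator hB).comp (hX k)
  refine measurable_to_countable' fun n => ?_
  have h2 : pointCount X B ⁻¹' {n} = (fun ω => (pointCount X B ω : ℝ≥0∞)) ⁻¹' {(n : ℝ≥0∞)} := by
    ext ω; simp
  rw [h2]
  exact h1 (measurableSet_singleton _)

end PointCount

lemma volumeReal_ball (x : Plane) {t : ℝ} (ht : 0 ≤ t) :
    volume.real (Metric.ball x t) = t ^ 2 * Real.pi := by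
  rw [measureReal_def, EuclideanSpace.volume_ball_fin_two, ENNReal.toReal_mul, ENNReal.toReal_pow,
    ENNReal.toReal_ofReal ht, ENNReal.toReal_ofReal Real.pi_pos.le]

/-- The constant in the mean interference from outside a disc of radius `2 * lam ^ (-1 / 2)`. -/
noncomputable def interferenceConst (α : ℝ) : ℝ := 16 * Real.pi * (1 - 2 ^ (2 - α))⁻¹

lemma interferenceConst_pos {α : ℝ} (hα : 2 < α) : 0 < interferenceConst α := by
  have hq : (2 : ℝ) ^ (2 - α) < 1 := Real.rpow_lt_one_of_one_lt_of_neg (by norm_num) (by linarith)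
  have : 0 < (1 - (2 : ℝ) ^ (2 - α))⁻¹ := inv_pos.2 (by linarith)
  unfold interferenceConst
  positivity

/-- A majorant of the path loss to a point `c`, for points outside the disc of radius `2 * ρ` around
`c` and outside `D`: it is a combination of indicators of bounded sets disjoint from `D`. -/
noncomputable def dyadicPathLoss (α ρ : ℝ) (c : Plane) (D : Set Plane) (y : Plane) : ℝ≥0∞ :=
  ∑' i : ℕ, ENNReal.ofReal ((2 ^ i * (2 * ρ)) ^ (-α)) *
    (Metric.ball c (2 ^ (i + 1) * (2 * ρ)) \ D).indicator 1 y

lemma measurable_dyadicPathLoss {α ρ : ℝ} {c : Plane} {D : Set Plane} (hD : MeasurableSet D) :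
    Measurable (dyadicPathLoss α ρ c D) :=
  Measurable.tsum fun _ => (measurable_one.indicator (measurableSet_ball.diff hD)).const_mul _

lemma edist_rpow_neg_le_dyadicPathLoss {α ρ : ℝ} (hα : 0 ≤ α) (hρ : 0 < ρ) {c x y : Plane}
    {D : Set Plane} (hx : dist x c ≤ ρ) (hy : 2 * ρ ≤ dist y c) (hyD : y ∉ D) :
    edist x y ^ (-α) ≤ ENNReal.ofReal (2 ^ α) * dyadicPathLoss α ρ c D y := by
  have h1 : dist y c / 2 ≤ dist x y := by
    have := dist_triangle y x c
    rw [dist_comm y x] at this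
    linarith
  have h2 : edist x y ^ (-α) ≤ ENNReal.ofReal (2 ^ α) * edist y c ^ (-α) := by
    rw [edist_dist, edist_dist, ENNReal.ofReal_rpow_of_pos (by linarith),
      ENNReal.ofReal_rpow_of_pos (by linarith), ← ENNReal.ofReal_mul (by positivity)]
    refine ENNReal.ofReal_le_ofReal ?_
    have h3 := Real.rpow_le_rpow_of_nonpos (by linarith) h1 (show -α ≤ 0 by linarith)
    rwa [Real.div_rpow dist_nonneg (by norm_num), Real.rpow_neg (by norm_num : (0 : ℝ) ≤ 2),
      div_inv_eq_mul, mul_comm] at h3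
  refine h2.trans ?_
  gcongr
  refine (edist_rpow_neg_le_tsum hα (by linarith) y c hy).trans_eq ?_
  refine tsum_congr fun i => ?_
  congr 1
  by_cases hb : y ∈ Metric.ball c (2 ^ (i + 1) * (2 * ρ))
  · rw [Set.indicator_of_mem hb, Set.indicator_of_mem (Set.mem_sdiff_of_mem hb hyD)]
  · rw [Set.indicator_of_notMem hb, Set.indicator_of_notMem fun h => hb h.1]

namespace IsHomogeneousPPP

variable {Ω : Type*} [MeasurableSpace Ω] {P : Measure Ω} {lam : ℝ} {X : ℕ → Ω → Plane}

lemma map_pointCount [IsProbabilityMeasure P] (hX : IsHomogeneousPPP P lam X) {B : Set Plane} (hB : MeasurableSet B)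
    (hB' : volume B ≠ ∞) :
    P.map (pointCount X B) =
      (poissonMeasure (Real.toNNReal (lam * volume.real B))).map (Nat.cast : ℕ → ℕ∞) := by
  have hm := measurable_pointCount hX.measurable hB
  have := Measure.isProbabilityMeasure_map (μ := P) hm.aemeasurable
  have hemb : MeasurableEmbedding (Nat.cast : ℕ → ℕ∞) :=
    ⟨Nat.cast_injective, measurable_from_nat, fun _ _ => MeasurableSet.of_discrete⟩
  have h1 : poissonMeasure (Real.toNNReal (lam * volume.real B)) =
      (P.map (pointCount X B)).comap (Nat.cast : ℕ → ℕ∞) := by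
    refine Measure.ext_of_singleton fun n => ?_
    rw [hemb.comap_apply, Set.image_singleton, Measure.map_apply hm (measurableSet_singleton _),
      ← hX.count_law B hB hB' n]
    rfl
  have := Measure.isProbabilityMeasure_map
    (μ := poissonMeasure (Real.toNNReal (lam * volume.real B)))
    (measurable_from_nat (f := (Nat.cast : ℕ → ℕ∞))).aemeasurable
  symm
  refine Measure.eq_of_le_of_measure_univ_eq ?_ (by simp)
  rw [h1, hemb.map_comap]
  exact Measure.restrict_le_self

lemma lintegral_pointCount [IsProbabilityMeasure P] (hX : IsHomogeneousPPP P lam X) {B : Set Plane} (hB : MeasurableSet B)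
    (hB' : volume B ≠ ∞) (g : ℕ∞ → ℝ≥0∞) :
    ∫⁻ ω, g (pointCount X B ω) ∂P =
      ∫⁻ n : ℕ, g n ∂poissonMeasure (Real.toNNReal (lam * volume.real B)) := by
  rw [← lintegral_map (f := g) (measurable_of_countable g)
    (measurable_pointCount hX.measurable hB), hX.map_pointCount hB hB',
    lintegral_map (measurable_of_countable g) measurable_from_nat]

lemma indepFun_pointCount (hX : IsHomogeneousPPP P lam X) {D B : Set Plane} (hD : MeasurableSet D)
    (hD' : volume D ≠ ∞) (hB : MeasurableSet B) (hB' : volume B ≠ ∞) (hDB : Disjoint D B) :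
    IndepFun (pointCount X D) (pointCount X B) P := by
  have h := hX.count_indep 2 ![D, B] (by simp [Fin.forall_fin_two, hD, hB])
    (by simp [Fin.forall_fin_two, hD', hB']) (by
      intro i j hij
      fin_cases i <;> fin_cases j <;> simp_all [Function.onFun, disjoint_comm])
  exact h.indepFun (i := 0) (j := 1) (by simp)

lemma lintegral_mul_pointCount (hX : IsHomogeneousPPP P lam X) {D B : Set Plane}
    (hD : MeasurableSet D) (hD' : volume D ≠ ∞) (hB : MeasurableSet B) (hB' : volume B ≠ ∞)
    (hDB : Disjoint D B) (f g : ℕ∞ → ℝ≥0∞) :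
    ∫⁻ ω, f (pointCount X D ω) * g (pointCount X B ω) ∂P =
      (∫⁻ ω, f (pointCount X D ω) ∂P) * ∫⁻ ω, g (pointCount X B ω) ∂P :=
  lintegral_mul_eq_lintegral_mul_lintegral_of_indepFun
    ((measurable_of_countable f).comp (measurable_pointCount hX.measurable hD))
    ((measurable_of_countable g).comp (measurable_pointCount hX.measurable hB))
    ((hX.indepFun_pointCount hD hD' hB hB' hDB).comp (measurable_of_countable f)
      (measurable_of_countable g))

lemma lintegral_coe_pointCount [IsProbabilityMeasure P] (hX : IsHomogeneousPPP P lam X) (hlam : 0 ≤ lam) {B : Set Plane}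
    (hB : MeasurableSet B) (hB' : volume B ≠ ∞) :
    ∫⁻ ω, (pointCount X B ω : ℝ≥0∞) ∂P = ENNReal.ofReal lam * volume B := by
  rw [hX.lintegral_pointCount hB hB' fun n => (n : ℝ≥0∞)]
  simp only [ENat.toENNReal_coe]
  rw [lintegral_natCast_poissonMeasure]
  change ENNReal.ofReal _ = _
  rw [ENNReal.ofReal_mul hlam, ofReal_measureReal hB']

lemma lintegral_pow_pointCount [IsProbabilityMeasure P] (hX : IsHomogeneousPPP P lam X) (hlam : 0 ≤ lam) {B : Set Plane}
    (hB : MeasurableSet B) (hB' : volume B ≠ ∞) (q : ℝ≥0) :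
    ∫⁻ ω, (q : ℝ≥0∞) ^ (pointCount X B ω).toNat ∂P =
      ENNReal.ofReal (Real.exp (-((1 - q) * (lam * volume.real B)))) := by
  rw [hX.lintegral_pointCount hB hB' fun n => (q : ℝ≥0∞) ^ n.toNat]
  simp only [ENat.toNat_natCast]
  rw [lintegral_pow_poissonMeasure, Real.coe_toNNReal _ (by positivity)]

/-- The probability that there is exactly one point in `D` and no point in `B`. -/
lemma measure_one_and_zero (hX : IsHomogeneousPPP P lam X) (hlam : 0 ≤ lam) {D B : Set Plane}
    (hD : MeasurableSet D) (hD' : volume D ≠ ∞) (hB : MeasurableSet B) (hB' : volume B ≠ ∞)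
    (hDB : Disjoint D B) :
    P {ω | pointCount X D ω = 1 ∧ pointCount X B ω = 0} = ENNReal.ofReal lam * volume D *
      ENNReal.ofReal (Real.exp (-(lam * (volume.real D + volume.real B)))) := by
  have h := (hX.indepFun_pointCount hD hD' hB hB' hDB).measure_inter_preimage_eq_mul {1} {0}
    (measurableSet_singleton _) (measurableSet_singleton _)
  have h1 := hX.count_law D hD hD' 1
  have h0 := hX.count_law B hB hB' 0
  rw [poissonMeasure_singleton, Real.coe_toNNReal _ (by positivity)] at h1 h0
  have hset : {ω | pointCount X D ω = 1 ∧ pointCount X B ω = 0} =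
      pointCount X D ⁻¹' {1} ∩ pointCount X B ⁻¹' {0} := rfl
  rw [hset, h]
  change P {ω | pointCount X D ω = (1 : ℕ)} * P {ω | pointCount X B ω = (0 : ℕ)} = _
  rw [h1, h0, ← ofReal_measureReal hD', ← ENNReal.ofReal_mul hlam,
    ← ENNReal.ofReal_mul (by positivity), ← ENNReal.ofReal_mul (by positivity)]
  congr 1
  rw [mul_add, neg_add, Real.exp_add]
  simp
  ring

/-! ### Palm-type bounds over a small cell -/

/-- The mean of the number of points in a small cell `D`, weighted with a factor `q` for each other
point in a disc of radius close to `r`. It decays like `exp (-b lam r ^ 2)`; removing `D` from the disc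
makes the two counts independent. -/
lemma lintegral_count_mul_pow_le [IsProbabilityMeasure P] (hX : IsHomogeneousPPP P lam X) {ρ : ℝ} (hlam : 0 ≤ lam)
    (hρ : 0 ≤ ρ) (hlamρ : lam * ρ ^ 2 = 1) {q : ℝ≥0} (hq : q ≤ 1) {D : Set Plane}
    (hD : MeasurableSet D) {z : Plane} (hDz : D ⊆ Metric.ball z ρ) (c : Plane) {r : ℝ}
    (hr : 0 ≤ r) :
    ∫⁻ ω, (pointCount X D ω : ℝ≥0∞) *
        (q : ℝ≥0∞) ^ (pointCount X (Metric.ball c (r - ρ) \ D) ω).toNat ∂P ≤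
      ENNReal.ofReal lam * volume D * ENNReal.ofReal
        (Real.exp (2 * Real.pi) * Real.exp (-((1 - q) * Real.pi / 2 * (lam * r ^ 2)))) := by
  have hDle := measure_mono (μ := volume) hDz
  have hD' : volume D ≠ ∞ := ne_top_of_le_ne_top measure_ball_lt_top.ne hDle
  set B := Metric.ball c (r - ρ) \ D with hBdef
  have hB : MeasurableSet B := measurableSet_ball.diff hD
  have hB' : volume B ≠ ∞ :=
    ne_top_of_le_ne_top measure_ball_lt_top.ne (measure_mono Set.sdiff_subset)
  rw [hX.lintegral_mul_pointCount hD hD' hB hB' Set.disjoint_sdiff_right (fun n => (n : ℝ≥0∞))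
    (fun n => (q : ℝ≥0∞) ^ n.toNat), hX.lintegral_coe_pointCount hlam hD hD',
    hX.lintegral_pow_pointCount hlam hB hB', ← Real.exp_add]
  gcongr
  have hq' : (q : ℝ) ≤ 1 := hq
  have hDr : volume.real D ≤ ρ ^ 2 * Real.pi := by
    rw [← volumeReal_ball z hρ]
    exact measureReal_mono hDz measure_ball_lt_top.ne
  have hvol : (r ^ 2 / 2 - 2 * ρ ^ 2) * Real.pi ≤ volume.real B := by
    have hpi := Real.pi_pos
    rcases le_total ρ r with h | h
    · have h1 := le_measureReal_sdiff (μ := volume) (s₁ := Metric.ball c (r - ρ)) (s₂ := D)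
        hD'
      rw [volumeReal_ball c (by linarith)] at h1
      nlinarith [sq_nonneg (r - 2 * ρ)]
    · have : 0 ≤ volume.real B := measureReal_nonneg
      have h2 : r ^ 2 / 2 - 2 * ρ ^ 2 ≤ 0 := by nlinarith
      exact (mul_nonpos_of_nonpos_of_nonneg h2 hpi.le).trans this
  have h3 : lam * ((r ^ 2 / 2 - 2 * ρ ^ 2) * Real.pi) ≤ lam * volume.real B := by gcongr
  have h4 : lam * ((r ^ 2 / 2 - 2 * ρ ^ 2) * Real.pi) =
      Real.pi * (lam * r ^ 2) / 2 - 2 * Real.pi := by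
    linear_combination (-2 * Real.pi) * hlamρ
  have h5 : (1 - q) * (Real.pi * (lam * r ^ 2) / 2 - 2 * Real.pi) ≤
      (1 - q) * (lam * volume.real B) := by
    rw [h4] at h3
    gcongr
  nlinarith [Real.pi_pos, q.coe_nonneg]

lemma lintegral_count_mul_dyadicPathLoss_le [IsProbabilityMeasure P]
    (hX : IsHomogeneousPPP P lam X) {α ρ : ℝ} (hα : 2 < α) (hlam : 0 ≤ lam) (hρ : 0 < ρ)
    {D : Set Plane} (hD : MeasurableSet D) (hD' : volume D ≠ ∞) (c : Plane) :
    ∫⁻ ω, (pointCount X D ω : ℝ≥0∞) *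
        (ENNReal.ofReal (2 ^ α) * ∑' l, dyadicPathLoss α ρ c D (X l ω)) ∂P ≤
      ENNReal.ofReal lam * volume D *
        ENNReal.ofReal (interferenceConst α * (lam * ρ ^ (2 - α))) := by
  set B : ℕ → Set Plane := fun i => Metric.ball c (2 ^ (i + 1) * (2 * ρ)) \ D with hBdef
  set a : ℕ → ℝ≥0∞ := fun i => ENNReal.ofReal ((2 ^ i * (2 * ρ)) ^ (-α)) with ha
  have hB : ∀ i, MeasurableSet (B i) := fun i => measurableSet_ball.diff hD
  have hBle : ∀ i, volume (B i) ≤ volume (Metric.ball c (2 ^ (i + 1) * (2 * ρ))) := fun i =>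
    measure_mono Set.sdiff_subset
  have hB' : ∀ i, volume (B i) ≠ ∞ := fun i =>
    ne_top_of_le_ne_top measure_ball_lt_top.ne (hBle i)
  have hcm : ∀ {E : Set Plane}, MeasurableSet E →
      Measurable fun ω => (pointCount X E ω : ℝ≥0∞) := fun hE =>
    (measurable_of_countable _).comp (measurable_pointCount hX.measurable hE)
  have hcc : ∀ i, Measurable fun ω =>
      (pointCount X D ω : ℝ≥0∞) * (pointCount X (B i) ω : ℝ≥0∞) := fun i => (hcm hD).mul (hcm (hB i))
  have h1 : ∀ ω, (pointCount X D ω : ℝ≥0∞) *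
      (ENNReal.ofReal (2 ^ α) * ∑' l, dyadicPathLoss α ρ c D (X l ω)) =
      ∑' i, ENNReal.ofReal (2 ^ α) * a i *
        ((pointCount X D ω : ℝ≥0∞) * (pointCount X (B i) ω : ℝ≥0∞)) := by
    intro ω
    simp_rw [dyadicPathLoss]
    rw [ENNReal.tsum_comm]
    simp_rw [ENNReal.tsum_mul_left, ← coe_pointCount, ← ENNReal.tsum_mul_left]
    refine tsum_congr fun i => ?_
    simp only [ha, hBdef]
    ring
  simp_rw [h1]
  rw [lintegral_tsum fun i => ((hcc i).const_mul (ENNReal.ofReal (2 ^ α) * a i)).aemeasurable]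
  have h2 : ∀ i, ∫⁻ ω, ENNReal.ofReal (2 ^ α) * a i *
        ((pointCount X D ω : ℝ≥0∞) * (pointCount X (B i) ω : ℝ≥0∞)) ∂P =
      ENNReal.ofReal (2 ^ α) * a i *
        (ENNReal.ofReal lam * volume D * (ENNReal.ofReal lam * volume (B i))) := by
    intro i
    rw [lintegral_const_mul _ (hcc i),
      hX.lintegral_mul_pointCount hD hD' (hB i) (hB' i) Set.disjoint_sdiff_right
        (fun n => (n : ℝ≥0∞)) (fun n => (n : ℝ≥0∞)),
      hX.lintegral_coe_pointCount hlam hD hD', hX.lintegral_coe_pointCount hlam (hB i) (hB' i)]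
  simp_rw [h2]
  calc _ ≤ ∑' i, ENNReal.ofReal lam * volume D * (ENNReal.ofReal (2 ^ α) * ENNReal.ofReal lam) *
        (a i * volume (Metric.ball c (2 ^ (i + 1) * (2 * ρ)))) := by
        refine ENNReal.tsum_le_tsum fun i => ?_
        calc _ = ENNReal.ofReal lam * volume D * (ENNReal.ofReal (2 ^ α) * ENNReal.ofReal lam) *
              (a i * volume (B i)) := by ring
          _ ≤ _ := by gcongr; exact Set.sdiff_subset
    _ = _ := by
        rw [ENNReal.tsum_mul_left, tsum_dyadic_volume hα (by positivity), mul_assoc,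
          ← ENNReal.ofReal_mul (by positivity), ← ENNReal.ofReal_mul (by positivity)]
        congr 2
        rw [interferenceConst, Real.mul_rpow (by norm_num) hρ.le, sub_eq_add_neg 2 α,
          Real.rpow_add (by norm_num) 2 (-α), Real.rpow_neg (by norm_num) α, Real.rpow_two]
        have : (2 : ℝ) ^ α ≠ 0 := by positivity
        field_simp
        ring

/-- The sum, over the transmitters in a small cell, of Markov's lower bound `1 - J / T` for the
probability that the interference at displacement `o` is at most `T`; here `J` is the mean interference
given the positions and `T` is a multiple of `lam ^ (α / 2)`. The subtraction in `[0, ∞]` is truncated,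
and the main contribution comes from the event that the cell has exactly one point and the disc around
the receiver no other. -/
lemma le_lintegral_tsum_one_sub [IsProbabilityMeasure P]
    (hX : IsHomogeneousPPP P lam X) {α ρ : ℝ} (hα : 2 < α) (hlam : 0 ≤ lam) (hρ : 0 < ρ)
    (hlamρ : lam * ρ ^ 2 = 1) {D : Set Plane} (hD : MeasurableSet D) {z : Plane}
    (hDz : D ⊆ Metric.ball z ρ) (o : Plane) {T : ℝ}
    (hT : T = 2 * Real.exp (5 * Real.pi) * interferenceConst α * (lam * ρ ^ (2 - α))) :
    ENNReal.ofReal lam * volume D * ENNReal.ofReal (Real.exp (-(5 * Real.pi)) / 2) ≤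
      ∫⁻ ω, ∑' k, D.indicator 1 (X k ω) *
        (1 - (∑' l : {l : ℕ // l ≠ k}, edist (X k ω + o) (X l ω) ^ (-α)) /
          ENNReal.ofReal T) ∂P := by
  have hlam' : 0 < lam := by
    rcases hlam.eq_or_lt with h | h
    · rw [← h] at hlamρ; simp at hlamρ
    · exact h
  have hC := interferenceConst_pos hα
  have hTpos : 0 < T := by rw [hT]; positivity
  have hD' : volume D ≠ ∞ := ne_top_of_le_ne_top measure_ball_lt_top.ne (measure_mono hDz)
  set c := z + o with hc
  set B := Metric.ball c (2 * ρ) \ D with hBdef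
  have hB : MeasurableSet B := measurableSet_ball.diff hD
  have hB' : volume B ≠ ∞ :=
    ne_top_of_le_ne_top measure_ball_lt_top.ne (measure_mono Set.sdiff_subset)
  set G := {ω | pointCount X D ω = 1 ∧ pointCount X B ω = 0} with hG
  have hGm : MeasurableSet G :=
    (measurable_pointCount hX.measurable hD (measurableSet_singleton 1)).inter
      (measurable_pointCount hX.measurable hB (measurableSet_singleton 0))
  set M : Ω → ℝ≥0∞ := fun ω => ENNReal.ofReal (2 ^ α) * ∑' l, dyadicPathLoss α ρ c D (X l ω)
    with hM
  have hMm : Measurable M :=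
    (Measurable.tsum fun l => (measurable_dyadicPathLoss hD).comp (hX.measurable l)).const_mul _
  have hGMm : Measurable fun ω => G.indicator 1 ω * M ω := (measurable_one.indicator hGm).mul hMm
  have hpoint : ∀ ω, G.indicator 1 ω - G.indicator 1 ω * M ω / ENNReal.ofReal T ≤
      ∑' k, D.indicator 1 (X k ω) *
        (1 - (∑' l : {l : ℕ // l ≠ k}, edist (X k ω + o) (X l ω) ^ (-α)) /
          ENNReal.ofReal T) := by
    intro ω
    by_cases hω : ω ∈ G
    swap
    · simp [hω]
    obtain ⟨h1, h0⟩ := hω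
    obtain ⟨k, hk⟩ := Set.encard_eq_one.1 h1
    have h0' : ∀ l, X l ω ∉ B := by
      intro l hl
      have : {k | X k ω ∈ B} = ∅ := Set.encard_eq_zero.1 h0
      exact Set.eq_empty_iff_forall_notMem.1 this l hl
    have hkD : X k ω ∈ D := by
      have : k ∈ {k | X k ω ∈ D} := by rw [hk]; rfl
      exact this
    have hlD : ∀ l, l ≠ k → X l ω ∉ D := by
      intro l hl hlD
      have : l ∈ {k | X k ω ∈ D} := hlD
      rw [hk] at this
      exact hl this
    refine le_trans ?_ (ENNReal.le_tsum k)
    rw [Set.indicator_of_mem (show ω ∈ G from ⟨h1, h0⟩), Set.indicator_of_mem hkD]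
    simp only [Pi.one_apply, one_mul]
    gcongr
    simp only [hM]
    rw [← ENNReal.tsum_mul_left]
    refine le_trans (ENNReal.tsum_le_tsum fun l : {l : ℕ // l ≠ k} => ?_)
      (ENNReal.tsum_comp_le_tsum_of_injective Subtype.val_injective
        fun l => ENNReal.ofReal (2 ^ α) * dyadicPathLoss α ρ c D (X l ω))
    refine edist_rpow_neg_le_dyadicPathLoss (by linarith) hρ ?_ ?_ (hlD l l.2)
    · rw [hc, dist_add_right]
      exact (hDz hkD).le
    · by_contra! hlt
      exact h0' l ⟨hlt, hlD l l.2⟩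
  refine le_trans ?_ (lintegral_mono hpoint)
  refine le_trans ?_ (lintegral_sub_le _ _ (hGMm.div_const _))
  have hGP : ENNReal.ofReal lam * volume D * ENNReal.ofReal (Real.exp (-(5 * Real.pi))) ≤
      ∫⁻ ω, G.indicator 1 ω ∂P := by
    rw [lintegral_indicator_one hGm, hG,
      hX.measure_one_and_zero hlam hD hD' hB hB' Set.disjoint_sdiff_right]
    refine mul_le_mul_right (ENNReal.ofReal_le_ofReal (Real.exp_le_exp.2 (neg_le_neg ?_))) _
    have h1 : volume.real D ≤ ρ ^ 2 * Real.pi := by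
      rw [← volumeReal_ball z hρ.le]; exact measureReal_mono hDz measure_ball_lt_top.ne
    have h2 : volume.real B ≤ (2 * ρ) ^ 2 * Real.pi := by
      rw [← volumeReal_ball c (by positivity)]
      exact measureReal_mono Set.sdiff_subset measure_ball_lt_top.ne
    calc lam * (volume.real D + volume.real B)
        ≤ lam * (ρ ^ 2 * Real.pi + (2 * ρ) ^ 2 * Real.pi) := by gcongr
      _ = 5 * Real.pi := by linear_combination 5 * Real.pi * hlamρ
  have hMP : ∫⁻ ω, G.indicator 1 ω * M ω / ENNReal.ofReal T ∂P ≤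
      ENNReal.ofReal lam * volume D * ENNReal.ofReal (Real.exp (-(5 * Real.pi)) / 2) := by
    simp_rw [div_eq_mul_inv]
    rw [lintegral_mul_const _ hGMm]
    calc _ ≤ (ENNReal.ofReal lam * volume D *
          ENNReal.ofReal (interferenceConst α * (lam * ρ ^ (2 - α)))) * (ENNReal.ofReal T)⁻¹ := by
          gcongr
          refine le_trans (lintegral_mono fun ω => ?_)
            (hX.lintegral_count_mul_dyadicPathLoss_le hα hlam hρ hD hD' c)
          gcongr
          by_cases hω : ω ∈ G
          · rw [Set.indicator_of_mem hω, hω.1]; simp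
          · simp [hω]
      _ = _ := by
          rw [← ENNReal.ofReal_inv_of_pos hTpos, mul_assoc, ← ENNReal.ofReal_mul (by positivity)]
          congr 2
          rw [hT, Real.exp_neg]
          field_simp
  calc _ = ENNReal.ofReal lam * volume D * ENNReal.ofReal (Real.exp (-(5 * Real.pi))) -
        ENNReal.ofReal lam * volume D * ENNReal.ofReal (Real.exp (-(5 * Real.pi)) / 2) := by
        rw [← ENNReal.mul_sub fun _ _ => ENNReal.mul_ne_top ENNReal.ofReal_ne_top hD',
          ← ENNReal.ofReal_sub _ (by positivity)]
        congr 2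
        ring
    _ ≤ _ := tsub_le_tsub hGP hMP

end IsHomogeneousPPP

/-! ### Localization -/

/-- Two measures on the plane can be compared on sets of small diameter. -/
lemma measure_le_of_forall_subset_ball {μ ν : Measure Plane} {ρ : ℝ} (hρ : 0 < ρ)
    (h : ∀ (z : Plane) (D : Set Plane), MeasurableSet D → D ⊆ Metric.ball z ρ → μ D ≤ ν D) :
    μ ≤ ν := by
  refine Measure.le_iff.2 fun A hA => ?_
  set B : ℕ → Set Plane := fun n => Metric.ball (TopologicalSpace.denseSeq Plane n) ρ with hB
  have hBm : ∀ n, MeasurableSet (B n) := fun n => measurableSet_ball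
  have hcov : ⋃ n, B n = Set.univ := by
    refine Set.eq_univ_of_forall fun x => ?_
    obtain ⟨n, hn⟩ := (TopologicalSpace.denseRange_denseSeq Plane).exists_dist_lt x hρ
    exact Set.mem_iUnion.2 ⟨n, hn⟩
  have hA' : A = ⋃ n, A ∩ disjointed B n := by
    rw [← Set.inter_iUnion, iUnion_disjointed, hcov, Set.inter_univ]
  have hdm : ∀ n, MeasurableSet (A ∩ disjointed B n) := fun n =>
    hA.inter (MeasurableSet.disjointed hBm n)
  have hdd : Pairwise (Function.onFun Disjoint fun n => A ∩ disjointed B n) := fun i j hij =>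
    (disjoint_disjointed B hij).mono Set.inter_subset_right Set.inter_subset_right
  rw [hA', measure_iUnion hdd hdm, measure_iUnion hdd hdm]
  exact ENNReal.tsum_le_tsum fun n => h _ _ (hdm n)
    (Set.inter_subset_right.trans (disjointed_subset B n))

lemma mul_rpow_neg_half_sq {lam : ℝ} (hlam : 0 < lam) : lam * (lam ^ (-(1 / 2) : ℝ)) ^ 2 = 1 := by
  rw [← Real.rpow_natCast, ← Real.rpow_mul hlam.le]
  norm_num
  rw [Real.rpow_neg_one, mul_inv_cancel₀ hlam.ne']

/-! ### Constants of the upper bound -/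

/-- The exponential decay rate `(1 - q) π / 2` of the Laplace transform of the interference. -/
noncomputable def decayRate : ℝ := (1 - gaussianSqLaplace.toReal) * Real.pi / 2

lemma decayRate_pos : 0 < decayRate := by
  have := ENNReal.toReal_strict_mono ENNReal.one_ne_top gaussianSqLaplace_lt_one
  rw [ENNReal.toReal_one] at this
  have := Real.pi_pos
  unfold decayRate
  have : 0 < 1 - gaussianSqLaplace.toReal := by linarith
  positivity

lemma one_le_mul_edist_rpow_neg {α s : ℝ} (hα : 0 < α) (hs : 0 < s) {x y : Plane}
    (h : dist x y ≤ s ^ (1 / α)) : 1 ≤ ENNReal.ofReal s * edist x y ^ (-α) := by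
  have h1 : edist x y ^ α ≤ ENNReal.ofReal s := by
    calc edist x y ^ α ≤ ENNReal.ofReal (s ^ (1 / α)) ^ α := by
          rw [edist_dist]; gcongr
      _ = ENNReal.ofReal s := by
          rw [ENNReal.ofReal_rpow_of_pos (by positivity), ← Real.rpow_mul hs.le,
            one_div_mul_cancel hα.ne', Real.rpow_one]
  rw [ENNReal.rpow_neg]
  calc (1 : ℝ≥0∞) = ENNReal.ofReal s * (ENNReal.ofReal s)⁻¹ :=
        (ENNReal.mul_inv_cancel (by simpa using hs) ENNReal.ofReal_ne_top).symm
    _ ≤ _ := by gcongr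

/-- The constant in the upper bound for the mean signal-to-interference ratio. -/
noncomputable def meanSIRConst (α : ℝ) : ℝ :=
  Real.exp (2 * Real.pi) * (decayRate ^ (-(α / 2)) * Real.Gamma (α / 2 + 1))

lemma meanSIRConst_pos {α : ℝ} (hα : 0 < α) : 0 < meanSIRConst α := by
  have := decayRate_pos
  have : 0 < Real.Gamma (α / 2 + 1) := Real.Gamma_pos_of_pos (by positivity)
  unfold meanSIRConst
  positivity

namespace LinkNetwork

variable {Ω : Type*} [MeasurableSpace Ω] {P : Measure Ω} {lam Rd : ℝ} {N : ℕ}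

/-! ### Measurability and independence in the network -/

lemma isStdComplexGaussianVector_fading (𝒩 : LinkNetwork P lam Rd N) (k l : ℕ) :
    IsStdComplexGaussianVector P (𝒩.fading k l) where
  measurable_coord := 𝒩.fading_measurable k l
  law := 𝒩.fading_law k l
  indep := 𝒩.fading_indep.precomp (g := fun i => (k, l, i)) fun i j h => by simpa using h

lemma measurable_fading (𝒩 : LinkNetwork P lam Rd N) (k l : ℕ) : Measurable (𝒩.fading k l) :=
  (𝒩.isStdComplexGaussianVector_fading k l).measurable

lemma iIndepFun_fading (𝒩 : LinkNetwork P lam Rd N) (k : ℕ) : iIndepFun (𝒩.fading k) P := by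
  have h1 := 𝒩.fading_indep.precomp (g := fun p : ℕ × Fin N => (k, p.1, p.2))
    fun p q h => by simpa [Prod.ext_iff] using h
  have h2 := iIndepFun_curry (X := fun l i ω => 𝒩.fading k l ω i) (𝒩.fading_measurable k) h1
  exact h2.comp (fun _ => MeasurableEquiv.toLp 2 (Fin N → ℂ)) fun _ => MeasurableEquiv.measurable _

lemma measurable_tx (𝒩 : LinkNetwork P lam Rd N) (k : ℕ) : Measurable (𝒩.tx k) :=
  𝒩.tx_ppp.measurable k

lemma measurable_mrcPower (𝒩 : LinkNetwork P lam Rd N) (k l : ℕ) :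
    Measurable (𝒩.mrcPower k l) :=
  measurable_combiningGain (𝒩.measurable_fading k k) (𝒩.measurable_fading k l)

lemma measurable_pathLoss (𝒩 : LinkNetwork P lam Rd N) (α : ℝ) (k l : ℕ) :
    Measurable (𝒩.pathLoss α k l) :=
  (((𝒩.measurable_tx k).add (𝒩.offset_measurable k)).edist (𝒩.measurable_tx l)).pow_const _

lemma measurable_interference (𝒩 : LinkNetwork P lam Rd N) (α : ℝ) (k : ℕ) :
    Measurable (𝒩.interference α k) :=
  Measurable.tsum fun l => (𝒩.measurable_mrcPower k l).mul (𝒩.measurable_pathLoss α k l)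

lemma measurable_mrcSINR (𝒩 : LinkNetwork P lam Rd N) (α : ℝ) (v : ℝ≥0∞) (k : ℕ) :
    Measurable (𝒩.mrcSINR α v k) :=
  ((𝒩.measurable_mrcPower k k).mul (𝒩.measurable_pathLoss α k k)).div
    ((𝒩.measurable_interference α k).add_const v)

lemma isProbabilityMeasure_cond_ring [IsProbabilityMeasure P] (𝒩 : LinkNetwork P lam Rd N) :
    IsProbabilityMeasure (cond (volume : Measure Plane) (ring Rd)) := by
  rw [← 𝒩.offset_law 0]
  exact Measure.isProbabilityMeasure_map (𝒩.offset_measurable 0).aemeasurable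

lemma measurableSet_ring : MeasurableSet (ring Rd) :=
  (measurableSet_le measurable_const measurable_norm).inter
    (measurableSet_le measurable_norm measurable_const)

lemma ae_offset_mem_ring (𝒩 : LinkNetwork P lam Rd N) (k : ℕ) :
    ∀ᵐ ω ∂P, 𝒩.offset k ω ∈ ring Rd := by
  refine ae_of_ae_map (𝒩.offset_measurable k).aemeasurable ?_
  rw [𝒩.offset_law k]
  exact ae_cond_mem measurableSet_ring

/-- Conditioning on the positions: the means over the displacement of receiver `k`, the transmitter
positions and the fading at receiver `k` can be taken one after the other. -/
lemma lintegral_link_eq [IsProbabilityMeasure P] (𝒩 : LinkNetwork P lam Rd N) (k : ℕ)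
    {F : (ℕ → Plane) → Plane → (ℕ → EuclideanSpace ℂ (Fin N)) → ℝ≥0∞}
    (hF : Measurable fun y : (ℕ → Plane) × Plane × (ℕ → EuclideanSpace ℂ (Fin N)) =>
      F y.1 y.2.1 y.2.2) :
    ∫⁻ ω, F (fun l => 𝒩.tx l ω) (𝒩.offset k ω) (fun l => 𝒩.fading k l ω) ∂P =
      ∫⁻ o, ∫⁻ ω, ∫⁻ ω', F (fun l => 𝒩.tx l ω) o (fun l => 𝒩.fading k l ω') ∂P ∂P
        ∂(cond volume (ring Rd)) := by
  have htx : Measurable fun ω l => 𝒩.tx l ω := measurable_pi_lambda _ 𝒩.measurable_tx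
  have hfa : Measurable fun ω l => 𝒩.fading k l ω := measurable_pi_lambda _ (𝒩.measurable_fading k)
  have hof := 𝒩.offset_measurable k
  have hlp : Measurable fun (w : ℕ → ℕ → Fin N → ℂ) (l : ℕ) => WithLp.toLp 2 (w k l) :=
    measurable_pi_lambda _ fun l => (MeasurableEquiv.toLp 2 (Fin N → ℂ)).measurable.comp
      ((measurable_pi_apply l).comp (measurable_pi_apply k))
  have hI1 : IndepFun (fun ω l => 𝒩.tx l ω) (fun ω => (𝒩.offset k ω, fun l => 𝒩.fading k l ω)) P :=
    𝒩.tx_indep.comp (φ := id)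
      (ψ := fun y : (ℕ → Plane) × (ℕ → ℕ → Fin N → ℂ) => (y.1 k, fun l => WithLp.toLp 2 (y.2 k l)))
      measurable_id
      (((measurable_pi_apply k).comp measurable_fst).prodMk (hlp.comp measurable_snd))
  have hI2 : IndepFun (𝒩.offset k) (fun ω l => 𝒩.fading k l ω) P :=
    𝒩.offset_indep_fading.comp (φ := fun y : ℕ → Plane => y k)
      (ψ := fun (w : ℕ → ℕ → Fin N → ℂ) (l : ℕ) => WithLp.toLp 2 (w k l))
      (measurable_pi_apply k) hlp
  rw [lintegral_comp_of_indepFun (f := fun x y => F x y.1 y.2) htx (hof.prodMk hfa) hI1 hF]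
  have h1 : ∀ ω, ∫⁻ ω', F (fun l => 𝒩.tx l ω) (𝒩.offset k ω') (fun l => 𝒩.fading k l ω') ∂P =
      ∫⁻ ω', ∫⁻ ω'', F (fun l => 𝒩.tx l ω) (𝒩.offset k ω') (fun l => 𝒩.fading k l ω'') ∂P ∂P :=
    fun ω => lintegral_comp_of_indepFun (f := fun o w => F (fun l => 𝒩.tx l ω) o w) hof hfa hI2
      (hF.comp (measurable_const.prodMk measurable_id))
  simp_rw [h1]
  have hG : Measurable fun y : (Ω × Plane) × Ω =>
      F (fun l => 𝒩.tx l y.1.1) y.1.2 (fun l => 𝒩.fading k l y.2) :=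
    hF.comp ((htx.comp (measurable_fst.comp measurable_fst)).prodMk
      ((measurable_snd.comp measurable_fst).prodMk (hfa.comp measurable_snd)))
  have hG1 := hG.lintegral_prod_right' (ν := P)
  have hG2 : Measurable fun y : Ω × Ω => ∫⁻ ω'', F (fun l => 𝒩.tx l y.1) (𝒩.offset k y.2)
      (fun l => 𝒩.fading k l ω'') ∂P := hG1.comp (measurable_fst.prodMk (hof.comp measurable_snd))
  have hG3 : Measurable fun o => ∫⁻ ω, ∫⁻ ω'', F (fun l => 𝒩.tx l ω) o
      (fun l => 𝒩.fading k l ω'') ∂P ∂P := (hG1.comp measurable_swap).lintegral_prod_right'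
  rw [lintegral_lintegral_swap (f := fun ω ω' => ∫⁻ ω'', F (fun l => 𝒩.tx l ω) (𝒩.offset k ω')
    (fun l => 𝒩.fading k l ω'') ∂P) hG2.aemeasurable, ← 𝒩.offset_law k, lintegral_map hG3 hof]

lemma tsum_lintegral_link_eq [IsProbabilityMeasure P] (𝒩 : LinkNetwork P lam Rd N)
    {F : ℕ → (ℕ → Plane) → Plane → (ℕ → EuclideanSpace ℂ (Fin N)) → ℝ≥0∞}
    (hF : ∀ k, Measurable fun y : (ℕ → Plane) × Plane × (ℕ → EuclideanSpace ℂ (Fin N)) =>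
      F k y.1 y.2.1 y.2.2) :
    ∑' k, ∫⁻ ω, F k (fun l => 𝒩.tx l ω) (𝒩.offset k ω) (fun l => 𝒩.fading k l ω) ∂P =
      ∫⁻ o, ∑' k, ∫⁻ ω, ∫⁻ ω', F k (fun l => 𝒩.tx l ω) o (fun l => 𝒩.fading k l ω') ∂P ∂P
        ∂(cond volume (ring Rd)) := by
  have htx : Measurable fun ω l => 𝒩.tx l ω := measurable_pi_lambda _ 𝒩.measurable_tx
  rw [lintegral_tsum]
  · exact tsum_congr fun k => 𝒩.lintegral_link_eq k (hF k)
  · intro k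
    have hfa : Measurable fun ω l => 𝒩.fading k l ω :=
      measurable_pi_lambda _ (𝒩.measurable_fading k)
    have hG : Measurable fun y : (Plane × Ω) × Ω =>
        F k (fun l => 𝒩.tx l y.1.2) y.1.1 (fun l => 𝒩.fading k l y.2) :=
      (hF k).comp ((htx.comp (measurable_snd.comp measurable_fst)).prodMk
        ((measurable_fst.comp measurable_fst).prodMk (hfa.comp measurable_snd)))
    exact (hG.lintegral_prod_right' (ν := P)).lintegral_prod_right'.aemeasurable

/-! ### The upper bound -/

/-- The Laplace transform at `s` of the interference, weighted with the signal power and summed over the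
links with transmitter in a small cell. -/
lemma tsum_lintegral_power_mul_expNeg_le [IsProbabilityMeasure P] (𝒩 : LinkNetwork P lam Rd N)
    {α ρ : ℝ} (hα : 0 < α) (hlam : 0 ≤ lam) (hρ : 0 ≤ ρ) (hlamρ : lam * ρ ^ 2 = 1) {D : Set Plane}
    (hD : MeasurableSet D) {z : Plane} (hDz : D ⊆ Metric.ball z ρ) {s : ℝ} (hs : 0 < s) :
    ∑' k, ∫⁻ ω, D.indicator 1 (𝒩.tx k ω) *
        (𝒩.mrcPower k k ω * expNeg (ENNReal.ofReal s * 𝒩.interference α k ω)) ∂P ≤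
      N * (ENNReal.ofReal lam * volume D * ENNReal.ofReal (Real.exp (2 * Real.pi) *
        Real.exp (-(decayRate * lam) * s ^ (2 / α)))) := by
  have := 𝒩.isProbabilityMeasure_cond_ring
  have hD1 : Measurable (D.indicator (1 : Plane → ℝ≥0∞)) := measurable_one.indicator hD
  set F : ℕ → (ℕ → Plane) → Plane → (ℕ → EuclideanSpace ℂ (Fin N)) → ℝ≥0∞ := fun k x o w =>
    D.indicator 1 (x k) * (combiningGain (w k) (w k) * expNeg (ENNReal.ofReal s *
      ∑' l : {l : ℕ // l ≠ k}, combiningGain (w k) (w l) * edist (x k + o) (x l) ^ (-α))) with hFdef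
  have hF : ∀ k, Measurable fun y : (ℕ → Plane) × Plane × (ℕ → EuclideanSpace ℂ (Fin N)) =>
      F k y.1 y.2.1 y.2.2 := by
    intro k
    have hx : ∀ l, Measurable fun y : (ℕ → Plane) × Plane × (ℕ → EuclideanSpace ℂ (Fin N)) =>
      y.1 l := fun l => by fun_prop
    have hw : ∀ l, Measurable fun y : (ℕ → Plane) × Plane × (ℕ → EuclideanSpace ℂ (Fin N)) =>
      y.2.2 l := fun l => by fun_prop
    refine (hD1.comp (hx k)).mul ((measurable_combiningGain (hw k) (hw k)).mul
      (measurable_expNeg.comp (Measurable.const_mul (Measurable.tsum fun l => ?_) _)))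
    exact (measurable_combiningGain (hw k) (hw l)).mul
      ((((hx k).add (by fun_prop)).edist (hx l)).pow_const _)
  have h1 := 𝒩.tsum_lintegral_link_eq hF
  change ∑' k, ∫⁻ ω, F k (fun l => 𝒩.tx l ω) (𝒩.offset k ω) (fun l => 𝒩.fading k l ω) ∂P ≤ _
  rw [h1]
  set q : ℝ≥0 := gaussianSqLaplace.toNNReal with hq
  have hqc : (q : ℝ≥0∞) = gaussianSqLaplace :=
    ENNReal.coe_toNNReal (gaussianSqLaplace_lt_one.trans ENNReal.one_lt_top).ne
  have hq1 : q ≤ 1 := by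
    rw [← ENNReal.coe_le_coe, hqc]; exact gaussianSqLaplace_lt_one.le
  set r := s ^ (1 / α) with hr
  have hrpos : 0 < r := by positivity
  have hbound : ∀ o : Plane, ∑' k, ∫⁻ ω, ∫⁻ ω',
      F k (fun l => 𝒩.tx l ω) o (fun l => 𝒩.fading k l ω') ∂P ∂P ≤
      N * (ENNReal.ofReal lam * volume D * ENNReal.ofReal (Real.exp (2 * Real.pi) *
        Real.exp (-(decayRate * lam) * s ^ (2 / α)))) := by
    intro o
    set B := Metric.ball (z + o) (r - ρ) \ D with hB
    have hBm : MeasurableSet B := measurableSet_ball.diff hD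
    have hcB := measurable_pointCount 𝒩.measurable_tx hBm
    have hcq : Measurable fun ω => (q : ℝ≥0∞) ^ (pointCount 𝒩.tx B ω).toNat :=
      (measurable_of_countable fun n : ℕ∞ => (q : ℝ≥0∞) ^ n.toNat).comp hcB
    have hDk : ∀ k, Measurable fun ω => D.indicator (1 : Plane → ℝ≥0∞) (𝒩.tx k ω) := fun k =>
      hD1.comp (𝒩.measurable_tx k)
    have hDq : ∀ k, Measurable fun ω => D.indicator 1 (𝒩.tx k ω) *
        (N * (q : ℝ≥0∞) ^ (pointCount 𝒩.tx B ω).toNat) := fun k => (hDk k).mul (hcq.const_mul _)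
    calc _ ≤ ∑' k, ∫⁻ ω, D.indicator 1 (𝒩.tx k ω) *
          (N * (q : ℝ≥0∞) ^ (pointCount 𝒩.tx B ω).toNat) ∂P := by
          refine ENNReal.tsum_le_tsum fun k => lintegral_mono fun ω => ?_
          simp only [hFdef]
          by_cases hk : 𝒩.tx k ω ∈ D
          swap
          · simp [hk]
          simp only [Set.indicator_of_mem hk, Pi.one_apply, one_mul]
          rw [hqc]
          refine lintegral_gain_mul_expNeg_tsum_le
            (𝒩.isStdComplexGaussianVector_fading k) (𝒩.iIndepFun_fading k)
            (a := fun l => edist (𝒩.tx k ω + o) (𝒩.tx l ω) ^ (-α))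
            (S := {l | 𝒩.tx l ω ∈ B}) fun l hl => ⟨?_, ?_⟩
          · rintro rfl
            exact hl.2 hk
          · refine one_le_mul_edist_rpow_neg hα hs ?_
            have h2 : dist (𝒩.tx k ω) z < ρ := hDz hk
            have h3 : dist (𝒩.tx l ω) (z + o) < r - ρ := hl.1
            have h4 := dist_triangle_right (𝒩.tx k ω + o) (𝒩.tx l ω) (z + o)
            rw [dist_add_right] at h4
            linarith
      _ = N * ∫⁻ ω, (pointCount 𝒩.tx D ω : ℝ≥0∞) *
            (q : ℝ≥0∞) ^ (pointCount 𝒩.tx B ω).toNat ∂P := by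
          rw [← lintegral_tsum fun k => (hDq k).aemeasurable,
            ← lintegral_const_mul' _ _ (ENNReal.natCast_ne_top N)]
          refine lintegral_congr fun ω => ?_
          rw [ENNReal.tsum_mul_right, coe_pointCount]
          ring
      _ ≤ _ := by
          gcongr
          refine (𝒩.tx_ppp.lintegral_count_mul_pow_le hlam hρ hlamρ hq1 hD hDz (z + o)
            hrpos.le).trans_eq ?_
          congr 4
          have h2 : r ^ 2 = s ^ (2 / α) := by
            rw [hr, ← Real.rpow_natCast, ← Real.rpow_mul hs.le]; congr 1; push_cast; ring
          rw [h2, decayRate, ← hqc, ENNReal.coe_toReal]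
          ring
  calc _ ≤ ∫⁻ _o : Plane, N * (ENNReal.ofReal lam * volume D * ENNReal.ofReal
        (Real.exp (2 * Real.pi) * Real.exp (-(decayRate * lam) * s ^ (2 / α))))
          ∂(cond volume (ring Rd)) := lintegral_mono hbound
    _ = _ := by rw [lintegral_const, measure_univ, mul_one]

lemma tsum_lintegral_mrcSINR_le [IsProbabilityMeasure P] (𝒩 : LinkNetwork P lam Rd N)
    {α ρ : ℝ} (hα : 0 < α) (hlam : 0 < lam) (hρ : 0 ≤ ρ) (hlamρ : lam * ρ ^ 2 = 1) {D : Set Plane}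
    (hD : MeasurableSet D) {z : Plane} (hDz : D ⊆ Metric.ball z ρ) :
    ∑' k, ∫⁻ ω, D.indicator 1 (𝒩.tx k ω) * 𝒩.mrcSINR α 0 k ω ∂P ≤
      N * (ENNReal.ofReal lam * volume D) *
        ENNReal.ofReal (meanSIRConst α * lam ^ (-(α / 2))) := by
  have hDk : ∀ k, Measurable fun ω => D.indicator (1 : Plane → ℝ≥0∞) (𝒩.tx k ω) := fun k =>
    (measurable_one.indicator hD).comp (𝒩.measurable_tx k)
  set H : ℕ → Ω → ℝ → ℝ≥0∞ := fun k ω s => D.indicator 1 (𝒩.tx k ω) *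
    (𝒩.mrcPower k k ω * expNeg (ENNReal.ofReal s * 𝒩.interference α k ω)) with hH
  have hHm : ∀ k, Measurable (Function.uncurry (H k)) := fun k =>
    ((hDk k).comp measurable_fst).mul (((𝒩.measurable_mrcPower k k).comp measurable_fst).mul
      (measurable_expNeg.comp (measurable_snd.ennreal_ofReal.mul
        ((𝒩.measurable_interference α k).comp measurable_fst))))
  have h1 : ∀ k, ∫⁻ ω, D.indicator 1 (𝒩.tx k ω) * 𝒩.mrcSINR α 0 k ω ∂P ≤
      ∫⁻ s in Set.Ioi (0 : ℝ), ∫⁻ ω, H k ω s ∂P := by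
    intro k
    rw [← lintegral_lintegral_swap (hHm k).aemeasurable]
    refine lintegral_mono_ae ?_
    filter_upwards [𝒩.ae_offset_mem_ring k] with ω hω
    have hpl : 𝒩.pathLoss α k k ω ≤ 1 := by
      have h2 : edist (𝒩.rx k ω) (𝒩.tx k ω) = ENNReal.ofReal ‖𝒩.offset k ω‖ := by
        rw [edist_dist, rx, dist_eq_norm, add_sub_cancel_left]
      rw [pathLoss, h2, ENNReal.rpow_neg, ENNReal.inv_le_one]
      exact ENNReal.one_le_rpow (ENNReal.one_le_ofReal.2 hω.1) hα
    have hm : Measurable fun s : ℝ =>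
        expNeg (ENNReal.ofReal s * 𝒩.interference α k ω) :=
      measurable_expNeg.comp (ENNReal.measurable_ofReal.mul_const _)
    simp only [hH]
    rw [lintegral_const_mul _ (hm.const_mul _), lintegral_const_mul _ hm]
    gcongr
    rw [mrcSINR, add_zero, div_eq_mul_inv]
    gcongr
    · exact mul_le_of_le_one_right' hpl
    · exact inv_le_lintegral_expNeg _
  calc _ ≤ ∑' k, ∫⁻ s in Set.Ioi (0 : ℝ), ∫⁻ ω, H k ω s ∂P := ENNReal.tsum_le_tsum h1
    _ = ∫⁻ s in Set.Ioi (0 : ℝ), ∑' k, ∫⁻ ω, H k ω s ∂P :=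
        (lintegral_tsum fun k => (hHm k).lintegral_prod_left'.aemeasurable).symm
    _ ≤ ∫⁻ s in Set.Ioi (0 : ℝ), N * (ENNReal.ofReal lam * volume D *
          ENNReal.ofReal (Real.exp (2 * Real.pi))) * ENNReal.ofReal
            (Real.exp (-(decayRate * lam) * s ^ (2 / α))) := by
        refine setLIntegral_mono' measurableSet_Ioi fun s hs => ?_
        refine (𝒩.tsum_lintegral_power_mul_expNeg_le hα hlam.le hρ hlamρ hD hDz hs).trans_eq ?_
        rw [ENNReal.ofReal_mul (Real.exp_pos _).le]
        ring
    _ = N * (ENNReal.ofReal lam * volume D *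
          ENNReal.ofReal (Real.exp (2 * Real.pi))) * ENNReal.ofReal
            ((decayRate * lam) ^ (-1 / (2 / α)) * Real.Gamma (1 / (2 / α) + 1)) := by
        rw [lintegral_const_mul _ (by fun_prop), lintegral_exp_neg_mul_rpow (by positivity)
          (mul_pos decayRate_pos hlam)]
    _ = _ := by
        rw [← mul_assoc, mul_assoc _ (ENNReal.ofReal (Real.exp _)),
          ← ENNReal.ofReal_mul (Real.exp_pos _).le, neg_div, one_div_div,
          Real.mul_rpow decayRate_pos.le hlam.le, meanSIRConst]
        congr 2
        ring

/-- The spectral efficiencies of the links as weights of their transmitters: the measure of a region is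
the mean sum of the spectral efficiencies of the links with transmitter in it. -/
noncomputable def efficiencyMeasure (𝒩 : LinkNetwork P lam Rd N) (α : ℝ) : Measure Plane :=
  Measure.sum fun k =>
    (P.withDensity fun ω => log2OnePlus (𝒩.mrcSINR α 0 k ω)).map (𝒩.tx k)

lemma efficiencyMeasure_apply (𝒩 : LinkNetwork P lam Rd N) (α : ℝ) {D : Set Plane}
    (hD : MeasurableSet D) :
    𝒩.efficiencyMeasure α D =
      ∑' k, ∫⁻ ω, D.indicator 1 (𝒩.tx k ω) * log2OnePlus (𝒩.mrcSINR α 0 k ω) ∂P := by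
  rw [efficiencyMeasure, Measure.sum_apply _ hD]
  refine tsum_congr fun k => ?_
  have hm := 𝒩.measurable_tx k hD
  rw [Measure.map_apply (𝒩.measurable_tx k) hD, withDensity_apply _ hm, ← lintegral_indicator hm]
  refine lintegral_congr fun ω => ?_
  by_cases h : 𝒩.tx k ω ∈ D
  · rw [Set.indicator_of_mem (show ω ∈ 𝒩.tx k ⁻¹' D from h), Set.indicator_of_mem h]
    simp
  · rw [Set.indicator_of_notMem (show ω ∉ 𝒩.tx k ⁻¹' D from h), Set.indicator_of_notMem h]
    simp

lemma mrcSumSpectralEfficiency_eq (𝒩 : LinkNetwork P lam Rd N) (α : ℝ) {A : Set Plane}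
    (hA : MeasurableSet A) :
    𝒩.mrcSumSpectralEfficiency α 0 A = 𝒩.efficiencyMeasure α A / volume A := by
  rw [mrcSumSpectralEfficiency, 𝒩.efficiencyMeasure_apply α hA, lintegral_tsum]
  · congr 1
    refine tsum_congr fun k => lintegral_congr fun ω => ?_
    by_cases h : 𝒩.tx k ω ∈ A
    · rw [Set.indicator_of_mem (show ω ∈ {ω' | 𝒩.tx k ω' ∈ A} from h), Set.indicator_of_mem h]
      simp
    · rw [Set.indicator_of_notMem (show ω ∉ {ω' | 𝒩.tx k ω' ∈ A} from h),
        Set.indicator_of_notMem h]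
      simp
  · intro k
    exact ((measurable_log2OnePlus.comp (𝒩.measurable_mrcSINR α 0 k)).indicator
      (𝒩.measurable_tx k hA)).aemeasurable

lemma tsum_lintegral_indicator_tx [IsProbabilityMeasure P] (𝒩 : LinkNetwork P lam Rd N)
    (hlam : 0 ≤ lam) {D : Set Plane} (hD : MeasurableSet D) (hD' : volume D ≠ ∞) :
    ∑' k, ∫⁻ ω, D.indicator 1 (𝒩.tx k ω) ∂P = ENNReal.ofReal lam * volume D := by
  have hDk : ∀ k, Measurable fun ω => D.indicator (1 : Plane → ℝ≥0∞) (𝒩.tx k ω) := fun k =>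
    (measurable_one.indicator hD).comp (𝒩.measurable_tx k)
  rw [← 𝒩.tx_ppp.lintegral_coe_pointCount hlam hD hD',
    ← lintegral_tsum fun k => (hDk k).aemeasurable]
  exact lintegral_congr fun ω => (coe_pointCount D ω).symm

lemma efficiencyMeasure_le [IsProbabilityMeasure P] (𝒩 : LinkNetwork P lam Rd N) {α m : ℝ}
    (hα : 0 < α) (hlam : 0 < lam) (hm : 0 < m) {K : ℝ} (hK : 0 ≤ K)
    (hN : N * lam ^ (-(α / 2)) ≤ K * m) :
    𝒩.efficiencyMeasure α ≤ ENNReal.ofReal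
      (lam * ((1 + K * meanSIRConst α) * Real.logb 2 (1 + m))) • volume := by
  refine measure_le_of_forall_subset_ball (ρ := lam ^ (-(1 / 2) : ℝ)) (by positivity)
    fun z D hD hDz => ?_
  have hD' : volume D ≠ ∞ := ne_top_of_le_ne_top measure_ball_lt_top.ne (measure_mono hDz)
  have hDk : ∀ k, Measurable fun ω => D.indicator (1 : Plane → ℝ≥0∞) (𝒩.tx k ω) := fun k =>
    (measurable_one.indicator hD).comp (𝒩.measurable_tx k)
  have hDS : ∀ k, Measurable fun ω => D.indicator 1 (𝒩.tx k ω) * 𝒩.mrcSINR α 0 k ω := fun k =>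
    (hDk k).mul (𝒩.measurable_mrcSINR α 0 k)
  have hU := meanSIRConst_pos hα
  have hlog : 0 ≤ Real.logb 2 (1 + m) := Real.logb_nonneg (by norm_num) (by linarith)
  have hl2 : 0 < Real.log 2 := Real.log_pos (by norm_num)
  set ε := 1 / ((1 + m) * Real.log 2) with hε
  have hεpos : 0 < ε := by positivity
  rw [𝒩.efficiencyMeasure_apply α hD, Measure.smul_apply, smul_eq_mul]
  calc _ ≤ ∑' k, (ENNReal.ofReal (Real.logb 2 (1 + m)) * ∫⁻ ω, D.indicator 1 (𝒩.tx k ω) ∂P +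
        ENNReal.ofReal ε * ∫⁻ ω, D.indicator 1 (𝒩.tx k ω) * 𝒩.mrcSINR α 0 k ω ∂P) := by
        refine ENNReal.tsum_le_tsum fun k => ?_
        rw [← lintegral_const_mul _ (hDk k),
          ← lintegral_const_mul _ (hDS k),
          ← lintegral_add_left ((hDk k).const_mul _)]
        refine lintegral_mono fun ω => ?_
        calc _ ≤ D.indicator 1 (𝒩.tx k ω) * (ENNReal.ofReal (Real.logb 2 (1 + m)) +
              ENNReal.ofReal ε * 𝒩.mrcSINR α 0 k ω) := by
              gcongr; exact log2OnePlus_le hm _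
          _ = _ := by ring
    _ ≤ ENNReal.ofReal (Real.logb 2 (1 + m)) * (ENNReal.ofReal lam * volume D) +
        ENNReal.ofReal ε * (N * (ENNReal.ofReal lam * volume D) *
          ENNReal.ofReal (meanSIRConst α * lam ^ (-(α / 2)))) := by
        rw [ENNReal.tsum_add, ENNReal.tsum_mul_left, ENNReal.tsum_mul_left,
          𝒩.tsum_lintegral_indicator_tx hlam.le hD hD']
        gcongr
        exact 𝒩.tsum_lintegral_mrcSINR_le hα hlam (by positivity) (mul_rpow_neg_half_sq hlam) hD hDz
    _ = ENNReal.ofReal (Real.logb 2 (1 + m) * lam +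
          ε * N * lam * (meanSIRConst α * lam ^ (-(α / 2)))) * volume D := by
        rw [← ENNReal.ofReal_natCast, ENNReal.ofReal_add (by positivity) (by positivity),
          ENNReal.ofReal_mul hlog, ENNReal.ofReal_mul (p := ε * N * lam) (by positivity),
          ENNReal.ofReal_mul (p := ε * N) (by positivity), ENNReal.ofReal_mul hεpos.le]
        ring
    _ ≤ _ := by
        gcongr
        have h1 : m * ε ≤ Real.logb 2 (1 + m) := div_le_logb_one_add hm
        calc _ = lam * (Real.logb 2 (1 + m) + ε * meanSIRConst α * (N * lam ^ (-(α / 2)))) := by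
              ring
          _ ≤ lam * (Real.logb 2 (1 + m) + ε * meanSIRConst α * (K * m)) := by gcongr
          _ = lam * (Real.logb 2 (1 + m) + K * meanSIRConst α * (m * ε)) := by ring
          _ ≤ lam * (Real.logb 2 (1 + m) + K * meanSIRConst α * Real.logb 2 (1 + m)) := by gcongr
          _ = _ := by ring

/-! ### The lower bound -/

/-- The mean number of links with transmitter in a small cell, direct channel in `E` and interference at
most `T`. -/
lemma le_tsum_lintegral_good_links [IsProbabilityMeasure P] (𝒩 : LinkNetwork P lam Rd N)
    {α ρ : ℝ} (hα : 2 < α) (hlam : 0 ≤ lam) (hρ : 0 < ρ) (hlamρ : lam * ρ ^ 2 = 1) {D : Set Plane}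
    (hD : MeasurableSet D) {z : Plane} (hDz : D ⊆ Metric.ball z ρ) {T : ℝ}
    (hT : T = 2 * Real.exp (5 * Real.pi) * interferenceConst α * (lam * ρ ^ (2 - α)))
    (hTpos : 0 < T) {E : Set (EuclideanSpace ℂ (Fin N))} (hE : MeasurableSet E) {p : ℝ≥0∞}
    (hp : ∀ k, p ≤ P (𝒩.fading k k ⁻¹' E)) :
    p * (ENNReal.ofReal lam * volume D * ENNReal.ofReal (Real.exp (-(5 * Real.pi)) / 2)) ≤
      ∑' k, ∫⁻ ω, D.indicator 1 (𝒩.tx k ω) * {ω | 𝒩.fading k k ω ∈ E ∧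
        𝒩.interference α k ω ≤ ENNReal.ofReal T}.indicator 1 ω ∂P := by
  have := 𝒩.isProbabilityMeasure_cond_ring
  have hD1 : Measurable (D.indicator (1 : Plane → ℝ≥0∞)) := measurable_one.indicator hD
  set J : ℕ → (ℕ → Plane) → Plane → (ℕ → EuclideanSpace ℂ (Fin N)) → ℝ≥0∞ := fun k x o w =>
    ∑' l : {l : ℕ // l ≠ k}, combiningGain (w k) (w l) * edist (x k + o) (x l) ^ (-α) with hJdef
  set S : ℕ → Set ((ℕ → Plane) × Plane × (ℕ → EuclideanSpace ℂ (Fin N))) := fun k =>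
    {y | y.2.2 k ∈ E ∧ J k y.1 y.2.1 y.2.2 ≤ ENNReal.ofReal T} with hS
  have hx : ∀ l, Measurable fun y : (ℕ → Plane) × Plane × (ℕ → EuclideanSpace ℂ (Fin N)) =>
    y.1 l := fun l => by fun_prop
  have hw : ∀ l, Measurable fun y : (ℕ → Plane) × Plane × (ℕ → EuclideanSpace ℂ (Fin N)) =>
    y.2.2 l := fun l => by fun_prop
  have hSm : ∀ k, MeasurableSet (S k) := by
    intro k
    have hJ : Measurable fun y : (ℕ → Plane) × Plane × (ℕ → EuclideanSpace ℂ (Fin N)) =>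
        J k y.1 y.2.1 y.2.2 := Measurable.tsum fun l =>
      (measurable_combiningGain (hw k) (hw l)).mul
        ((((hx k).add (by fun_prop)).edist (hx l)).pow_const _)
    exact (hw k hE).inter (measurableSet_le hJ measurable_const)
  set F : ℕ → (ℕ → Plane) → Plane → (ℕ → EuclideanSpace ℂ (Fin N)) → ℝ≥0∞ := fun k x o w =>
    D.indicator 1 (x k) * (S k).indicator 1 (x, o, w) with hFdef
  have hF : ∀ k, Measurable fun y : (ℕ → Plane) × Plane × (ℕ → EuclideanSpace ℂ (Fin N)) =>
      F k y.1 y.2.1 y.2.2 := fun k =>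
    (hD1.comp (hx k)).mul (measurable_one.indicator (hSm k))
  have h1 := 𝒩.tsum_lintegral_link_eq hF
  change _ ≤ ∑' k, ∫⁻ ω, F k (fun l => 𝒩.tx l ω) (𝒩.offset k ω) (fun l => 𝒩.fading k l ω) ∂P
  rw [h1]
  have hbound : ∀ o : Plane,
      p * (ENNReal.ofReal lam * volume D * ENNReal.ofReal (Real.exp (-(5 * Real.pi)) / 2)) ≤
      ∑' k, ∫⁻ ω, ∫⁻ ω', F k (fun l => 𝒩.tx l ω) o (fun l => 𝒩.fading k l ω') ∂P ∂P := by
    intro o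
    have hJ : ∀ k, Measurable fun ω =>
        ∑' l : {l : ℕ // l ≠ k}, edist (𝒩.tx k ω + o) (𝒩.tx l ω) ^ (-α) := fun k =>
      Measurable.tsum fun l => (((𝒩.measurable_tx k).add_const o).edist
        (𝒩.measurable_tx l)).pow_const _
    have hm : ∀ k, Measurable fun ω => D.indicator 1 (𝒩.tx k ω) *
        (1 - (∑' l : {l : ℕ // l ≠ k}, edist (𝒩.tx k ω + o) (𝒩.tx l ω) ^ (-α)) /
          ENNReal.ofReal T) := fun k =>
      (hD1.comp (𝒩.measurable_tx k)).mul (((hJ k).div_const _).const_sub _)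
    calc _ ≤ p * ∫⁻ ω, ∑' k, D.indicator 1 (𝒩.tx k ω) *
          (1 - (∑' l : {l : ℕ // l ≠ k}, edist (𝒩.tx k ω + o) (𝒩.tx l ω) ^ (-α)) /
            ENNReal.ofReal T) ∂P := by
          gcongr
          exact 𝒩.tx_ppp.le_lintegral_tsum_one_sub hα hlam hρ hlamρ hD hDz o hT
      _ = ∑' k, ∫⁻ ω, p * (D.indicator 1 (𝒩.tx k ω) *
          (1 - (∑' l : {l : ℕ // l ≠ k}, edist (𝒩.tx k ω + o) (𝒩.tx l ω) ^ (-α)) /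
            ENNReal.ofReal T)) ∂P := by
          rw [lintegral_tsum fun k => (hm k).aemeasurable, ← ENNReal.tsum_mul_left]
          exact tsum_congr fun k => (lintegral_const_mul _ (hm k)).symm
      _ ≤ _ := by
          refine ENNReal.tsum_le_tsum fun k => lintegral_mono fun ω => ?_
          simp only [hFdef]
          by_cases hk : 𝒩.tx k ω ∈ D
          swap
          · simp [hk]
          simp only [Set.indicator_of_mem hk, Pi.one_apply, one_mul]
          have h2 := mul_one_sub_le_measure_gain_interference
            (𝒩.isStdComplexGaussianVector_fading k) (𝒩.iIndepFun_fading k)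
            (a := fun l => edist (𝒩.tx k ω + o) (𝒩.tx l ω) ^ (-α)) (T := ENNReal.ofReal T)
            (by simpa using hTpos) ENNReal.ofReal_ne_top hE (hp k)
          refine h2.trans (le_of_eq ?_)
          have hfa : Measurable fun ω' => ((fun l => 𝒩.tx l ω, o, fun l => 𝒩.fading k l ω') :
              (ℕ → Plane) × Plane × (ℕ → EuclideanSpace ℂ (Fin N))) :=
            measurable_const.prodMk (measurable_const.prodMk
              (measurable_pi_lambda _ (𝒩.measurable_fading k)))
          exact (lintegral_indicator_one (hfa (hSm k))).symm
  calc _ = ∫⁻ _o : Plane, p * (ENNReal.ofReal lam * volume D *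
        ENNReal.ofReal (Real.exp (-(5 * Real.pi)) / 2)) ∂(cond volume (ring Rd)) := by
        rw [lintegral_const, measure_univ, mul_one]
    _ ≤ _ := lintegral_mono hbound

lemma le_efficiencyMeasure [IsProbabilityMeasure P] (𝒩 : LinkNetwork P lam Rd N) {α : ℝ}
    (hα : 2 < α) (hlam : 0 < lam) {η p : ℝ} (hη : 0 ≤ η)
    (hp : ∀ k, ENNReal.ofReal p ≤ P {ω | η * N ≤ ‖𝒩.fading k k ω‖ ^ 2}) {s : ℝ} (hs : 0 ≤ s)
    (hs' : s ≤ η * N * Rd ^ (-α) /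
      (2 * Real.exp (5 * Real.pi) * interferenceConst α * lam ^ (α / 2))) :
    ENNReal.ofReal (lam * (p * (Real.exp (-(5 * Real.pi)) / 2) * Real.logb 2 (1 + s))) • volume ≤
      𝒩.efficiencyMeasure α := by
  set ρ := lam ^ (-(1 / 2) : ℝ) with hρdef
  have hρ : 0 < ρ := by positivity
  have hlamρ : lam * ρ ^ 2 = 1 := mul_rpow_neg_half_sq hlam
  refine measure_le_of_forall_subset_ball hρ fun z D hD hDz => ?_
  have hC := interferenceConst_pos hα
  set T := 2 * Real.exp (5 * Real.pi) * interferenceConst α * lam ^ (α / 2) with hT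
  have hTpos : 0 < T := by positivity
  have hT' : T = 2 * Real.exp (5 * Real.pi) * interferenceConst α * (lam * ρ ^ (2 - α)) := by
    rw [hT, hρdef, ← Real.rpow_mul hlam.le]
    nth_rw 2 [← Real.rpow_one lam]
    rw [← Real.rpow_add hlam]
    congr 2
    ring
  have hE : MeasurableSet {v : EuclideanSpace ℂ (Fin N) | η * N ≤ ‖v‖ ^ 2} :=
    measurableSet_le measurable_const (measurable_norm.pow_const 2)
  have hgood := 𝒩.le_tsum_lintegral_good_links hα hlam.le hρ hlamρ hD hDz hT' hTpos hE hp
  have hlog : 0 ≤ Real.logb 2 (1 + s) := Real.logb_nonneg (by norm_num) (by linarith)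
  rw [𝒩.efficiencyMeasure_apply α hD, Measure.smul_apply, smul_eq_mul]
  calc _ ≤ ENNReal.ofReal (Real.logb 2 (1 + s)) * (ENNReal.ofReal p * (ENNReal.ofReal lam *
        volume D * ENNReal.ofReal (Real.exp (-(5 * Real.pi)) / 2))) := by
        rw [ENNReal.ofReal_mul hlam.le, ENNReal.ofReal_mul' hlog,
          ENNReal.ofReal_mul' (by positivity)]
        exact le_of_eq (by ring)
    _ ≤ ENNReal.ofReal (Real.logb 2 (1 + s)) * _ := mul_le_mul_right hgood _
    _ = ∑' k, ∫⁻ ω, ENNReal.ofReal (Real.logb 2 (1 + s)) * (D.indicator 1 (𝒩.tx k ω) *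
          {ω | 𝒩.fading k k ω ∈ {v : EuclideanSpace ℂ (Fin N) | η * N ≤ ‖v‖ ^ 2} ∧
            𝒩.interference α k ω ≤ ENNReal.ofReal T}.indicator 1 ω) ∂P := by
        rw [← ENNReal.tsum_mul_left]
        exact tsum_congr fun k => (lintegral_const_mul' _ _ ENNReal.ofReal_ne_top).symm
    _ ≤ _ := by
        refine ENNReal.tsum_le_tsum fun k => lintegral_mono_ae ?_
        filter_upwards [𝒩.ae_offset_mem_ring k] with ω hω
        rw [← mul_assoc, mul_comm (ENNReal.ofReal _), mul_assoc]
        gcongr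
        by_cases hg : ω ∈ {ω | η * N ≤ ‖𝒩.fading k k ω‖ ^ 2 ∧
            𝒩.interference α k ω ≤ ENNReal.ofReal T}
        swap
        · rw [Set.indicator_of_notMem hg, mul_zero]; exact zero_le
        rw [Set.indicator_of_mem hg, Pi.one_apply, mul_one, ← log2OnePlus_ofReal hs]
        refine log2OnePlus_mono ?_
        have hoff : 0 < ‖𝒩.offset k ω‖ := lt_of_lt_of_le one_pos hω.1
        have hpl : ENNReal.ofReal (Rd ^ (-α)) ≤ 𝒩.pathLoss α k k ω := by
          have h2 : edist (𝒩.rx k ω) (𝒩.tx k ω) = ENNReal.ofReal ‖𝒩.offset k ω‖ := by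
            rw [edist_dist, rx, dist_eq_norm, add_sub_cancel_left]
          rw [pathLoss, h2, ENNReal.ofReal_rpow_of_pos hoff]
          exact ENNReal.ofReal_le_ofReal
            (Real.rpow_le_rpow_of_nonpos hoff hω.2 (by linarith))
        have hpow : ENNReal.ofReal (η * N) ≤ 𝒩.mrcPower k k ω := by
          change _ ≤ combiningGain (𝒩.fading k k ω) (𝒩.fading k k ω)
          rw [combiningGain_self]
          exact ENNReal.ofReal_le_ofReal hg.1
        calc ENNReal.ofReal s ≤ ENNReal.ofReal (η * N * Rd ^ (-α) / T) :=
              ENNReal.ofReal_le_ofReal hs'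
          _ = ENNReal.ofReal (η * N) * ENNReal.ofReal (Rd ^ (-α)) / ENNReal.ofReal T := by
              rw [ENNReal.ofReal_div_of_pos hTpos, ENNReal.ofReal_mul (by positivity)]
          _ ≤ _ := by
              rw [mrcSINR, add_zero]
              gcongr
              exact hg.2

end LinkNetwork

/-! ### The scaling law -/

theorem theorem2 (α Rd c β : ℝ) (hα : 2 < α) (hRd : 1 < Rd) (hc : 0 < c) (hβ : 0 ≤ β) :
    ∃ k₁ > (0 : ℝ), ∃ k₂ > (0 : ℝ), ∃ lam₀ > (0 : ℝ), ∀ lam : ℝ, lam₀ ≤ lam →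
      ∀ N : ℕ, 0 < N → |(N : ℝ) - c * lam ^ β| < 1 →
      ∀ (Ω : Type*) [MeasurableSpace Ω] (P : Measure Ω) [IsProbabilityMeasure P]
        (𝒩 : LinkNetwork P lam Rd N)
        (A : Set Plane), MeasurableSet A → volume A ≠ 0 → volume A ≠ ∞ →
        ENNReal.ofReal (k₁ * Real.logb 2 (1 + lam ^ (β - α / 2))) ≤
            𝒩.mrcSumSpectralEfficiency α 0 A / ENNReal.ofReal lam ∧
          𝒩.mrcSumSpectralEfficiency α 0 A / ENNReal.ofReal lam ≤
            ENNReal.ofReal (k₂ * Real.logb 2 (1 + lam ^ (β - α / 2))) := by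
  obtain ⟨η, hη, p, hp, hchernoff⟩ := exists_norm_sq_ge_prob
  have hα0 : 0 < α := by linarith
  have hU := meanSIRConst_pos hα0
  have hC := interferenceConst_pos hα
  have hRd0 : 0 < Rd := by linarith
  set κ := min 1 (η * (c / 2) * Rd ^ (-α) / (2 * Real.exp (5 * Real.pi) * interferenceConst α))
    with hκ
  have hκ0 : 0 < κ := lt_min one_pos (by positivity)
  refine ⟨p * (Real.exp (-(5 * Real.pi)) / 2) * κ, by positivity,
    1 + (c + 1) * meanSIRConst α, by positivity, 1, one_pos, ?_⟩
  intro lam hlam1 N hN hNc Ω _ P _ 𝒩 A hA hA0 hA1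
  have hlam : 0 < lam := by linarith
  set m := lam ^ (β - α / 2) with hm
  have hm0 : 0 < m := by positivity
  have hlog : 0 ≤ Real.logb 2 (1 + m) := Real.logb_nonneg (by norm_num) (by linarith)
  have hβ1 : 1 ≤ lam ^ β := Real.one_le_rpow hlam1 hβ
  have hmβ : m = lam ^ β * lam ^ (-(α / 2)) := by rw [hm, ← Real.rpow_add hlam]; rfl
  obtain ⟨hN1, hN2⟩ := abs_lt.1 hNc
  have hN1' : (1 : ℝ) ≤ N := by exact_mod_cast hN
  have hNup : (N : ℝ) ≤ (c + 1) * lam ^ β := by linarith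
  -- `|N - c lam ^ β| < 1` alone gives no such bound when `c lam ^ β` is small; then `1 ≤ N` does.
  have hNlow : c / 2 * lam ^ β ≤ N := by linarith
  have hup := 𝒩.efficiencyMeasure_le hα0 hlam hm0 (K := c + 1) (by positivity) (by
    rw [hmβ, ← mul_assoc]; gcongr)
  have hlow := 𝒩.le_efficiencyMeasure hα hlam hη.le
    (fun k => hchernoff hN (𝒩.isStdComplexGaussianVector_fading k k)) (s := κ * m)
    (by positivity) (by
      calc κ * m ≤ (η * (c / 2) * Rd ^ (-α) /
            (2 * Real.exp (5 * Real.pi) * interferenceConst α)) * m := by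
            gcongr; exact min_le_right _ _
        _ = η * (c / 2 * lam ^ β) * Rd ^ (-α) /
            (2 * Real.exp (5 * Real.pi) * interferenceConst α * lam ^ (α / 2)) := by
            rw [hmβ, Real.rpow_neg hlam.le]; field_simp
        _ ≤ _ := by gcongr)
  have hlam' : ENNReal.ofReal lam ≠ 0 := by simpa using hlam
  rw [𝒩.mrcSumSpectralEfficiency_eq α hA]
  constructor
  · rw [ENNReal.le_div_iff_mul_le (Or.inl hlam') (Or.inl ENNReal.ofReal_ne_top),
      ENNReal.le_div_iff_mul_le (Or.inl hA0) (Or.inl hA1), ← ENNReal.ofReal_mul (by positivity)]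
    refine le_trans ?_ (hlow A)
    rw [Measure.smul_apply, smul_eq_mul]
    refine mul_le_mul_left (ENNReal.ofReal_le_ofReal ?_) _
    calc _ = lam * (p * (Real.exp (-(5 * Real.pi)) / 2) * (κ * Real.logb 2 (1 + m))) := by ring
      _ ≤ _ := by
          gcongr
          exact mul_logb_one_add_le hκ0.le (min_le_left _ _) hm0.le
  · rw [ENNReal.div_le_iff hlam' ENNReal.ofReal_ne_top, ENNReal.div_le_iff hA0 hA1,
      ← ENNReal.ofReal_mul (by positivity)]
    refine (hup A).trans_eq ?_
    rw [Measure.smul_apply, smul_eq_mul, mul_comm lam]
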